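/- For a Borel probability measure $\mu$ on $\mathbb{C}$ whose support is an infinite subset of the unit circle $\partial\mathbb{D}$, let $\Phi_n(\cdot;\mu)$, $n\ge 0$, be the monic orthogonal polynomials of $\mu$ (obtained by Gram–Schmidt orthogonalization of $1,z,z^2,\dots$ in $L^2(\mathbb{C},\mu)$, with leading coefficient $1$), and for $n\ge 1$ let $$\Phi_n^{(-1)}(z;\mu)=z\,\Phi_{n-1}(z;\mu)+z^{n-1}\,\overline{\Phi_{n-1}(1/\bar z;\mu)}$$ be the degree $n$ paraorthogonal polynomial. (i) Let $\mu$ be a probability measure whose support is an infinite subset of $\partial\mathbb{D}$, let $\mathcal N=\{n_1<n_2<\cdots\}$ be an infinite set of positive integers and let $f$ be a function such that $$\lim_{n\to\infty,\ n\in\mathcal N}\frac{\Phi_{n-1}(z;\mu)}{\Phi_n^{(-1)}(z;\mu)}=f(z)\quad\text{for every } z\in\mathbb{C} \text{ with } |z|>1. \qquad (1)$$ Then there is a probability measure $\nu$ supported on $\partial\mathbb{D}$ such that $$f(z)=\int_{\partial\mathbb{D}}\frac{1}{z-w}\,d\nu(w)\quad\text{for every } z\in\mathbb{C} \text{ with }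 |z|>1. \qquad (2)$$ (ii) Conversely, if $\nu$ is any probability measure supported on $\partial\mathbb{D}$ and $f$ is given by (2), then there are a probability measure $\mu$ whose support is an infinite subset of $\partial\mathbb{D}$ and an infinite set $\mathcal N$ of positive integers such that (1) holds. -/

import Mathlib

open MeasureTheory Filter Topology Polynomial

noncomputable section

namespace CirclePolynomials

/-- The inner product `∫ conj(P(w)) Q(w) dμ(w)` of two polynomials in `L²(ℂ, μ)`. -/
def polyInner (μ : Measure ℂ) (P Q : ℂ[X]) : ℂ :=
  ∫ w, starRingEnd ℂ (P.eval w) * Q.eval w ∂μ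

/-- The monic orthogonal polynomial `Φ_n(· ; μ)`, by (unnormalized) Gram-Schmidt orthogonalization
of `1, X, X², …` with respect to `polyInner μ`. It is used for finite measures whose support is
bounded and infinite, so that no denominator vanishes. -/
def monicOP (μ : Measure ℂ) (n : ℕ) : ℂ[X] :=
  X ^ n - ∑ j : Fin n,
    C (polyInner μ (monicOP μ j.1) (X ^ n) / polyInner μ (monicOP μ j.1) (monicOP μ j.1)) *
      monicOP μ j.1
termination_by n
decreasing_by all_goals exact j.2

/-- For a polynomial `P` of degree at most `m`, the polynomial
`z ↦ z ^ m * conj (P (1 / conj z))`: conjugate the coefficients and reverse their order. -/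
def starReverse (m : ℕ) (P : ℂ[X]) : ℂ[X] :=
  (P.map (starRingEnd ℂ)).reflect m

/-- The paraorthogonal polynomial of degree `n` (for `n ≥ 1`):
`Φ_n^{(-1)}(z) = z Φ_{n-1}(z) + z ^ (n-1) * conj (Φ_{n-1}(1 / conj z))`. -/
def paraOP (μ : Measure ℂ) (n : ℕ) : ℂ[X] :=
  X * monicOP μ (n - 1) + starReverse (n - 1) (monicOP μ (n - 1))

/-- `μ` is a probability measure on `ℂ` whose support is contained in the unit circle. -/
def IsCircleProbability (μ : Measure ℂ) : Prop :=
  IsProbabilityMeasure μ ∧ μ.support ⊆ Metric.sphere (0 : ℂ) 1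

/-- `Φ_{n-1}(z; μ) / Φ_n^{(-1)}(z; μ) → f z` for every `|z| > 1`, as `n` runs through the
strictly increasing sequence `N 0 < N 1 < …`. -/
def RatioTendsto (μ : Measure ℂ) (N : ℕ → ℕ) (f : ℂ → ℂ) : Prop :=
  ∀ z : ℂ, 1 < ‖z‖ →
    Tendsto (fun k => (monicOP μ (N k - 1)).eval z / (paraOP μ (N k)).eval z) atTop (𝓝 (f z))

/-- `f z = ∫ 1 / (z - w) dν(w)` for every `|z| > 1`. -/
def IsCauchyTransform (ν : Measure ℂ) (f : ℂ → ℂ) : Prop :=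
  ∀ z : ℂ, 1 < ‖z‖ → f z = ∫ w, 1 / (z - w) ∂ν

end CirclePolynomials

end

open scoped ComplexConjugate

noncomputable section

namespace CirclePolynomials

/-! Put `u = 1 / conj z`, a point of the unit disc, and `b_n = Φ_n / Φ_n^*`. Then `Φ_n(z) /
Φ_{n+1}^{(-1)}(z)` is the conjugate of `u / (1 + u * b_n(u))` (`monicOP_div_paraOP`), while the
Cauchy transform of `ν` at `z` is the conjugate of `u * discCauchy ν u`. So the theorem concerns the
limits of `1 / (1 + u * b_n(u))`.

(i) The Szegő recursion gives `|b_n| ≤ 1` in the disc. Hence `1 / (1 + u * b_n)` has real part at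
least `1/2` and value `1` at `0`, and Riesz-Herglotz (`exists_eq_discCauchy`) makes it the transform
of a probability measure. Weak compactness passes this to the limit.

(ii) By the Schwarz lemma, `discCauchy ν u = 1 / (1 + u * g(u))` with `g` analytic and `|g| ≤ 1`.
The `b_n` are iterates of the inverse Schur algorithm in which the newest Verblunsky coefficient
acts outermost. A long block of Schur coefficients of a function close to `g`, in reverse order,
therefore brings the iterate near `g` whatever came before, because each step contracts the
pseudo-hyperbolic distance (`schurStep_contraction`). Concatenating ever longer blocks gives `b_{N k
- 1} → g` (`exists_schurIter_tendsto`), and Verblunsky's theorem (`exists_monicOP_eq_of_verblunsky`)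
supplies the measure `μ`. -/

/-! ### Probability measures on the circle: integration, densities, weak compactness. -/

theorem IsCircleProbability.ae_mem {μ : Measure ℂ} (h : IsCircleProbability μ) :
    ∀ᵐ w ∂μ, w ∈ Metric.sphere (0 : ℂ) 1 :=
  mem_of_superset Measure.support_mem_ae h.2

theorem IsCircleProbability.of_ae_mem {μ : Measure ℂ} [IsProbabilityMeasure μ]
    (h : ∀ᵐ w ∂μ, w ∈ Metric.sphere (0 : ℂ) 1) : IsCircleProbability μ :=
  ⟨inferInstance, Measure.support_subset_of_isClosed Metric.isClosed_sphere h⟩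

theorem IsCircleProbability.integrable {E : Type*} [NormedAddCommGroup E]
    {μ : Measure ℂ} (h : IsCircleProbability μ) {g : ℂ → E}
    (hg : ContinuousOn g (Metric.sphere 0 1)) : Integrable g μ := by
  have := h.1
  have h1 : IntegrableOn g (Metric.sphere 0 1) μ := hg.integrableOn_compact (isCompact_sphere 0 1)
  rwa [IntegrableOn, Measure.restrict_eq_self_of_ae_mem h.ae_mem] at h1

theorem IsCircleProbability.integral_congr {E : Type*} [NormedAddCommGroup E] [NormedSpace ℝ E]
    {μ : Measure ℂ} (h : IsCircleProbability μ) {f g : ℂ → E}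
    (hfg : ∀ w, ‖w‖ = 1 → f w = g w) : ∫ w, f w ∂μ = ∫ w, g w ∂μ :=
  integral_congr_ae (h.ae_mem.mono fun w hw => hfg w (by simpa using hw))

/-- A nonnegative density of total mass `1` on the unit circle defines a probability measure. -/
theorem exists_isCircleProbability_density {D : ℂ → ℝ} (hD : ContinuousOn D (Metric.sphere 0 1))
    (hpos : ∀ w, ‖w‖ = 1 → 0 ≤ D w) (hone : Real.circleAverage D 0 1 = 1) :
    ∃ μ : Measure ℂ, IsCircleProbability μ ∧ ∀ g : ℂ → ℂ, ContinuousOn g (Metric.sphere 0 1) →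
      ∫ w, g w ∂μ = Real.circleAverage (fun w => (D w : ℂ) * g w) 0 1 := by
  have hmem (θ : ℝ) : circleMap 0 1 θ ∈ Metric.sphere (0 : ℂ) 1 :=
    circleMap_mem_sphere 0 zero_le_one θ
  have hDc : Continuous fun θ : ℝ => (2 * Real.pi)⁻¹ * D (circleMap 0 1 θ) :=
    continuous_const.mul (hD.comp_continuous (continuous_circleMap 0 1) hmem)
  have hDpos (θ : ℝ) : 0 ≤ (2 * Real.pi)⁻¹ * D (circleMap 0 1 θ) :=
    mul_nonneg (by positivity) (hpos _ (by simp))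
  set d : ℝ → NNReal := fun θ => Real.toNNReal ((2 * Real.pi)⁻¹ * D (circleMap 0 1 θ)) with hd
  have hdm : Measurable d := (continuous_real_toNNReal.comp hDc).measurable
  set m : Measure ℝ := (volume.restrict (Set.Ioc 0 (2 * Real.pi))).withDensity
    (fun θ => (d θ : ENNReal)) with hm
  have hmeas : Measurable (circleMap 0 1) := (continuous_circleMap 0 1).measurable
  have hmap : ∀ᵐ w ∂(m.map (circleMap 0 1)), w ∈ Metric.sphere (0 : ℂ) 1 := by
    exact (ae_map_iff hmeas.aemeasurable Metric.isClosed_sphere.measurableSet).2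
      (Eventually.of_forall hmem)
  have hprob : IsProbabilityMeasure (m.map (circleMap 0 1)) := by
    have : IsProbabilityMeasure m := by
      constructor
      rw [hm, withDensity_apply _ MeasurableSet.univ, Measure.restrict_univ]
      have h1 : ∫ θ in Set.Ioc 0 (2 * Real.pi), (2 * Real.pi)⁻¹ * D (circleMap 0 1 θ) = 1 := by
        rw [← intervalIntegral.integral_of_le (by positivity),
          intervalIntegral.integral_const_mul, ← smul_eq_mul, ← Real.circleAverage_def, hone]
      have h2 := ofReal_integral_eq_lintegral_ofReal
        (μ := volume.restrict (Set.Ioc 0 (2 * Real.pi)))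
        (f := fun θ => (2 * Real.pi)⁻¹ * D (circleMap 0 1 θ))
        ((hDc.integrableOn_Icc).mono_set Set.Ioc_subset_Icc_self)
        (Eventually.of_forall hDpos)
      rw [h1, ENNReal.ofReal_one] at h2
      exact h2.symm
    exact Measure.isProbabilityMeasure_map hmeas.aemeasurable
  refine ⟨m.map (circleMap 0 1), .of_ae_mem hmap, fun g hg => ?_⟩
  have hgi := (IsCircleProbability.of_ae_mem hmap).integrable hg
  rw [integral_map hmeas.aemeasurable hgi.aestronglyMeasurable, hm,
    integral_withDensity_eq_integral_smul hdm, Real.circleAverage_def,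
    intervalIntegral.integral_of_le (by positivity), ← integral_smul]
  refine integral_congr_ae (Eventually.of_forall fun θ => ?_)
  simp only [hd, NNReal.smul_def, Real.coe_toNNReal _ (hDpos θ), Complex.real_smul]
  push_cast
  ring

/-- Weak compactness of the set of probability measures on the circle, along an ultrafilter. -/
theorem exists_tendsto_hyperfilter {μ : ℕ → Measure ℂ} (hμ : ∀ n, IsCircleProbability (μ n)) :
    ∃ ν : Measure ℂ, IsCircleProbability ν ∧ ∀ g : ℂ → ℂ, ContinuousOn g (Metric.sphere 0 1) →
      Tendsto (fun n => ∫ w, g w ∂(μ n)) (hyperfilter ℕ) (𝓝 (∫ w, g w ∂ν)) := by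
  have hemb : MeasurableEmbedding (Subtype.val : Metric.sphere (0 : ℂ) 1 → ℂ) :=
    MeasurableEmbedding.subtype_coe Metric.isClosed_sphere.measurableSet
  have hcomap (n : ℕ) : ((μ n).comap (Subtype.val : Metric.sphere (0 : ℂ) 1 → ℂ)).map
      Subtype.val = μ n := by
    rw [hemb.map_comap, Subtype.range_coe]
    exact Measure.restrict_eq_self_of_ae_mem (hμ n).ae_mem
  have hp (n : ℕ) : IsProbabilityMeasure
      ((μ n).comap (Subtype.val : Metric.sphere (0 : ℂ) 1 → ℂ)) := by
    constructor
    have := (hμ n).1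
    rw [← measure_univ (μ := μ n), ← hcomap n, hemb.map_apply, hcomap n, Set.preimage_univ]
  let p : ℕ → ProbabilityMeasure (Metric.sphere (0 : ℂ) 1) := fun n => ⟨_, hp n⟩
  -- Probability measures on the compact circle form a compact space, so every ultrafilter has a
  -- limit. The hyperfilter is finer than `atTop`, so limits along `atTop` are kept and no
  -- subsequence is needed.
  obtain ⟨q, -, hq⟩ := isCompact_univ.ultrafilter_le_nhds ((hyperfilter ℕ).map p) (by simp)
  have hq' : Tendsto p (hyperfilter ℕ) (𝓝 q) := hq
  have hνmap : ∀ᵐ w ∂((q : Measure (Metric.sphere (0 : ℂ) 1)).map Subtype.val),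
      w ∈ Metric.sphere (0 : ℂ) 1 := by
    exact (ae_map_iff hemb.measurable.aemeasurable Metric.isClosed_sphere.measurableSet).2
      (Eventually.of_forall fun x => x.2)
  have : IsProbabilityMeasure ((q : Measure (Metric.sphere (0 : ℂ) 1)).map Subtype.val) :=
    Measure.isProbabilityMeasure_map hemb.measurable.aemeasurable
  refine ⟨_, .of_ae_mem hνmap, fun g hg => ?_⟩
  have hgc : Continuous fun x : Metric.sphere (0 : ℂ) 1 => g x :=
    continuousOn_iff_continuous_domRestrict.1 hg
  have key (G : Metric.sphere (0 : ℂ) 1 → ℝ) (hG : Continuous G) :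
      Tendsto (fun n => ∫ x, G x ∂(p n : Measure (Metric.sphere (0 : ℂ) 1))) (hyperfilter ℕ)
        (𝓝 (∫ x, G x ∂(q : Measure (Metric.sphere (0 : ℂ) 1)))) :=
    (ProbabilityMeasure.tendsto_iff_forall_integral_tendsto.1 hq')
      (BoundedContinuousFunction.mkOfCompact ⟨G, hG⟩)
  have hint (r : ProbabilityMeasure (Metric.sphere (0 : ℂ) 1)) :
      ∫ x, g x ∂(r : Measure (Metric.sphere (0 : ℂ) 1)) =
        ((∫ x, (g x).re ∂(r : Measure (Metric.sphere (0 : ℂ) 1)) : ℝ) : ℂ) +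
        ((∫ x, (g x).im ∂(r : Measure (Metric.sphere (0 : ℂ) 1)) : ℝ) : ℂ) * Complex.I :=
    (integral_re_add_im (𝕜 := ℂ)
      (hgc.integrable_of_hasCompactSupport (HasCompactSupport.of_compactSpace _))).symm
  have h1 (n : ℕ) : ∫ w, g w ∂(μ n) = ∫ x, g x ∂(p n : Measure (Metric.sphere (0 : ℂ) 1)) := by
    rw [← hcomap n, hemb.integral_map]; rfl
  rw [hemb.integral_map]
  simp only [h1, hint]
  exact ((Complex.continuous_ofReal.tendsto _).comp
    (key _ (Complex.continuous_re.comp hgc))).add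
    (((Complex.continuous_ofReal.tendsto _).comp
    (key _ (Complex.continuous_im.comp hgc))).mul_const _)

/-! ### The Cauchy transform in the disc. -/

/-- The Cauchy transform `∫ 1 / (1 - u conj w) dν(w)` in the unit disc. -/
def discCauchy (ν : Measure ℂ) (u : ℂ) : ℂ := ∫ w, 1 / (1 - u * conj w) ∂ν

theorem one_sub_norm_le {u w : ℂ} (hw : ‖w‖ = 1) : 1 - ‖u‖ ≤ ‖1 - u * conj w‖ := by
  have h := norm_sub_norm_le (1 : ℂ) (u * conj w)
  simpa [hw] using h

theorem one_sub_mul_conj_ne_zero {u w : ℂ} (hu : ‖u‖ < 1) (hw : ‖w‖ = 1) :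
    1 - u * conj w ≠ 0 :=
  norm_pos_iff.1 (lt_of_lt_of_le (sub_pos.2 hu) (one_sub_norm_le hw))

theorem continuousOn_discKernel {u : ℂ} (hu : ‖u‖ < 1) :
    ContinuousOn (fun w : ℂ => 1 / (1 - u * conj w)) (Metric.sphere 0 1) :=
  continuousOn_const.div (by fun_prop)
    fun w hw => one_sub_mul_conj_ne_zero hu (by simpa using hw)

/-- The Möbius map `v ↦ 1 / (1 - v)` carries the unit disc onto the half-plane `Re > 1/2`. -/
theorem half_le_re_one_div_one_sub {v : ℂ} (hv : ‖v‖ < 1) : 1 / 2 ≤ (1 / (1 - v)).re := by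
  have hne : 1 - v ≠ 0 := by
    intro h
    rw [← sub_eq_zero.1 h] at hv
    simp at hv
  have h1 : Complex.normSq v < 1 := by
    rw [Complex.normSq_eq_norm_sq]
    nlinarith [norm_nonneg v]
  have h2 : 0 < Complex.normSq (1 - v) := Complex.normSq_pos.2 hne
  rw [one_div (1 - v), Complex.inv_re, div_le_div_iff₀ two_pos h2]
  simp only [Complex.normSq_apply, Complex.sub_re, Complex.sub_im, Complex.one_re,
    Complex.one_im] at *
  nlinarith

theorem discCauchy_zero {ν : Measure ℂ} (hν : IsCircleProbability ν) : discCauchy ν 0 = 1 := by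
  have := hν.1
  simp [discCauchy]

theorem half_le_re_discCauchy {ν : Measure ℂ} (hν : IsCircleProbability ν) {u : ℂ}
    (hu : ‖u‖ < 1) : 1 / 2 ≤ (discCauchy ν u).re := by
  have := hν.1
  have hint := hν.integrable (continuousOn_discKernel hu)
  have h1 : (discCauchy ν u).re = ∫ w, (1 / (1 - u * conj w)).re ∂ν :=
    (integral_re hint).symm
  have h2 : (1 / 2 : ℝ) = ∫ _, (1 / 2 : ℝ) ∂ν := by simp
  rw [h1, h2]
  refine integral_mono_ae (integrable_const _) hint.re (hν.ae_mem.mono fun w hw => ?_)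
  exact half_le_re_one_div_one_sub (by simpa [mem_sphere_zero_iff_norm.1 hw] using hu)

theorem differentiableOn_discCauchy {ν : Measure ℂ} (hν : IsCircleProbability ν) :
    DifferentiableOn ℂ (discCauchy ν) (Metric.ball 0 1) := by
  intro u₀ hu₀
  have := hν.1
  rw [mem_ball_zero_iff] at hu₀
  -- Half the distance from `u₀` to the circle: for `u` within `ε` of `u₀` the denominator has
  -- modulus at least `ε`, whence the dominating constant `1 / ε ^ 2`.
  set ε := (1 - ‖u₀‖) / 2 with hε
  have hεpos : 0 < ε := by linarith
  have hnear {u : ℂ} (hu : u ∈ Metric.ball u₀ ε) : ‖u‖ ≤ 1 - ε := by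
    rw [mem_ball_iff_norm] at hu
    have := norm_sub_norm_le u u₀
    linarith
  refine (hasDerivAt_integral_of_dominated_loc_of_deriv_le
    (F := fun u w => 1 / (1 - u * conj w))
    (F' := fun u w => conj w / (1 - u * conj w) ^ 2) (bound := fun _ => 1 / ε ^ 2)
    (Metric.ball_mem_nhds u₀ hεpos) ?_ (hν.integrable (continuousOn_discKernel hu₀)) ?_ ?_
    (integrable_const _) ?_).2.differentiableAt.differentiableWithinAt
  · filter_upwards [Metric.ball_mem_nhds u₀ hεpos] with u hu
    exact (hν.integrable (continuousOn_discKernel (by linarith [hnear hu]))).aestronglyMeasurable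
  · refine (hν.integrable (ContinuousOn.div (by fun_prop) (by fun_prop) fun w hw => ?_))
      |>.aestronglyMeasurable
    exact pow_ne_zero 2 (one_sub_mul_conj_ne_zero hu₀ (by simpa using hw))
  · filter_upwards [hν.ae_mem] with w hw u hu
    rw [mem_sphere_zero_iff_norm] at hw
    rw [norm_div, norm_pow, RCLike.norm_conj, hw]
    have := one_sub_norm_le (u := u) hw
    gcongr
    linarith [hnear hu]
  · filter_upwards [hν.ae_mem] with w hw u hu
    rw [mem_sphere_zero_iff_norm] at hw
    have hne := one_sub_mul_conj_ne_zero (u := u) (by linarith [hnear hu]) hw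
    have h1 : HasDerivAt (fun u : ℂ => 1 - u * conj w) (-conj w) u := by
      simpa using ((hasDerivAt_id u).mul_const (conj w)).const_sub 1
    simp only [one_div]
    exact (h1.inv hne).congr_deriv (by simp)

/-- Pointwise limits of disc Cauchy transforms are disc Cauchy transforms. -/
theorem exists_eq_discCauchy_of_tendsto {μ : ℕ → Measure ℂ} (hμ : ∀ n, IsCircleProbability (μ n))
    {F : ℂ → ℂ} (hF : ∀ u, ‖u‖ < 1 → Tendsto (fun n => discCauchy (μ n) u) atTop (𝓝 (F u))) :
    ∃ ν, IsCircleProbability ν ∧ ∀ u, ‖u‖ < 1 → F u = discCauchy ν u := by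
  obtain ⟨ν, hν, hlim⟩ := exists_tendsto_hyperfilter hμ
  refine ⟨ν, hν, fun u hu => tendsto_nhds_unique ?_ (hlim _ (continuousOn_discKernel hu))⟩
  exact (hF u hu).mono_left Nat.hyperfilter_le_atTop

/-! ### Poisson representation and the Riesz-Herglotz theorem. -/

theorem circleAverage_conj {g : ℂ → ℂ} (hg : ContinuousOn g (Metric.sphere 0 1)) :
    Real.circleAverage (fun w => conj (g w)) 0 1 = conj (Real.circleAverage g 0 1) :=
  (Complex.conjCLE : ℂ →L[ℝ] ℂ).circleAverage_comp_comm (hg.circleIntegrable zero_le_one)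

/-- On the circle `conj w = 1 / w`, so the kernel is `w / (w - u)` and this is Cauchy's integral
formula. -/
theorem circleAverage_div_one_sub {G : ℂ → ℂ} (hG : DiffContOnCl ℂ G (Metric.ball 0 1)) {u : ℂ}
    (hu : ‖u‖ < 1) :
    Real.circleAverage (fun w => G w * (1 / (1 - u * conj w))) 0 1 = G u := by
  rw [← DiffContOnCl.circleAverage_smul_div (f := G) (c := 0) (R := 1) (by simpa using hG)
    (by simpa using hu)]
  refine Real.circleAverage_congr_sphere fun w hw => ?_
  have hw1 : ‖w‖ = 1 := by simpa using hw
  have hw0 : w ≠ 0 := by rintro rfl; simp at hw1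
  have hc : conj w = w⁻¹ := (Complex.inv_eq_conj hw1).symm
  have h1 := one_sub_mul_conj_ne_zero hu hw1
  rw [hc] at h1 ⊢
  have h2 : w - u ≠ 0 := by
    intro h
    rw [sub_eq_zero.1 h] at hw1
    linarith
  simp only [smul_eq_mul, sub_zero]
  have h3 : (1 - u * w⁻¹) = (w - u) / w := by field_simp
  rw [h3]
  field_simp

/-- The Poisson representation of a function analytic beyond the closed disc. -/
theorem exists_eq_discCauchy_of_diffContOnCl {G : ℂ → ℂ}
    (hG : DiffContOnCl ℂ G (Metric.ball 0 1)) (hG0 : G 0 = 1)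
    (hre : ∀ w, ‖w‖ = 1 → 1 / 2 ≤ (G w).re) :
    ∃ ν, IsCircleProbability ν ∧ ∀ u, ‖u‖ < 1 → G u = discCauchy ν u := by
  have hGs : ContinuousOn G (Metric.sphere 0 1) := by
    refine hG.continuousOn.mono ?_
    rw [closure_ball (0 : ℂ) one_ne_zero]
    exact Metric.sphere_subset_closedBall
  have hD : ContinuousOn (fun w => 2 * (G w).re - 1) (Metric.sphere 0 1) :=
    (continuousOn_const.mul (Complex.continuous_re.comp_continuousOn hGs)).sub continuousOn_const
  have key (u : ℂ) (hu : ‖u‖ < 1) : Real.circleAverage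
      (fun w => (((2 * (G w).re - 1 : ℝ)) : ℂ) * (1 / (1 - u * conj w))) 0 1 = G u := by
    have hk := continuousOn_discKernel hu
    have hden : ∀ w ∈ closure (Metric.ball (0 : ℂ) 1), 1 - conj u * w ≠ 0 := by
      intro w hw h
      rw [closure_ball (0 : ℂ) one_ne_zero, mem_closedBall_zero_iff] at hw
      have h1 : ‖conj u * w‖ = 1 := by rw [← sub_eq_zero.1 h, norm_one]
      rw [norm_mul, RCLike.norm_conj] at h1
      nlinarith [norm_nonneg u, norm_nonneg w]
    have hA : DiffContOnCl ℂ (fun w => (1 - conj u * w)⁻¹ * G w) (Metric.ball 0 1) :=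
      (Differentiable.diffContOnCl (by fun_prop : Differentiable ℂ fun w => 1 - conj u * w)).inv
        hden |>.smul hG
    have hAs : ContinuousOn (fun w => (1 - conj u * w)⁻¹ * G w) (Metric.sphere 0 1) := by
      refine hA.continuousOn.mono ?_
      rw [closure_ball (0 : ℂ) one_ne_zero]
      exact Metric.sphere_subset_closedBall
    -- The density is `G + conj G - 1`. The outer terms are Cauchy integrals with values `G u` and
    -- `1`; the middle one is the conjugate of a function analytic in `w`, with mean `conj (G 0) =
    -- 1`.
    have hsplit : Set.EqOn (fun w => (((2 * (G w).re - 1 : ℝ)) : ℂ) * (1 / (1 - u * conj w)))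
        (fun w => G w * (1 / (1 - u * conj w)) + conj ((1 - conj u * w)⁻¹ * G w)
          - (fun _ : ℂ => (1 : ℂ)) w * (1 / (1 - u * conj w)))
        (Metric.sphere 0 |1|) := by
      intro w _
      have h2 : (((2 * (G w).re - 1 : ℝ)) : ℂ) = G w + conj (G w) - 1 := by
        rw [Complex.add_conj]; push_cast; ring
      simp only [h2, map_mul, map_inv₀, map_sub, map_one, Complex.conj_conj]
      ring
    have hi1 := (hGs.mul hk).circleIntegrable (R := 1) zero_le_one
    have hi2 := (Complex.continuous_conj.comp_continuousOn hAs).circleIntegrable (R := 1)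
      zero_le_one
    have hi3 := ((continuousOn_const (c := (1 : ℂ))).mul hk).circleIntegrable (R := 1)
      zero_le_one
    rw [Real.circleAverage_congr_sphere hsplit]
    refine (Real.circleAverage_fun_sub (hi1.add hi2) hi3).trans ?_
    refine (congrArg (· - _) (Real.circleAverage_fun_add hi1 hi2)).trans ?_
    have h3 := circleAverage_div_one_sub diffContOnCl_const (G := fun _ => 1) hu
    have h4 := circleAverage_conj hAs
    have h5 := DiffContOnCl.circleAverage (R := 1) (by rwa [abs_one])
      (f := fun w => (1 - conj u * w)⁻¹ * G w) (c := 0)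
    rw [h5] at h4
    exact (congrArg₂ (· - ·) (congrArg₂ (· + ·) (circleAverage_div_one_sub hG hu) h4) h3).trans
      (by simp [hG0])
  have hone : Real.circleAverage (fun w => 2 * (G w).re - 1) 0 1 = 1 := by
    -- At `u = 0` the kernel is `1`, so `key` computes the total mass.
    have h0 := key 0 (by simp)
    rw [hG0] at h0
    have h1 := Complex.ofRealCLM.circleAverage_comp_comm
      (hD.circleIntegrable (R := 1) zero_le_one)
    have h2 : ((Real.circleAverage (fun w => 2 * (G w).re - 1) 0 1 : ℝ) : ℂ) = 1 := by
      refine Eq.trans ?_ h0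
      refine h1.symm.trans (congrArg (fun f => Real.circleAverage f 0 1) ?_)
      ext w
      simp
    exact_mod_cast h2
  obtain ⟨ν, hν, hint⟩ := exists_isCircleProbability_density hD
    (fun w hw => by linarith [hre w hw]) hone
  exact ⟨ν, hν, fun u hu => by rw [discCauchy, hint _ (continuousOn_discKernel hu), key u hu]⟩

/-- The Riesz-Herglotz theorem for the disc Cauchy transform. -/
theorem exists_eq_discCauchy {F : ℂ → ℂ} (hF : DifferentiableOn ℂ F (Metric.ball 0 1))
    (hF0 : F 0 = 1) (hre : ∀ u, ‖u‖ < 1 → 1 / 2 ≤ (F u).re) :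
    ∃ ν, IsCircleProbability ν ∧ ∀ u, ‖u‖ < 1 → F u = discCauchy ν u := by
  -- The dilations `u ↦ F (r u)` with `r = n / (n + 1) < 1` are analytic across the circle; they
  -- converge to `F` as `r → 1`.
  have hr1 (n : ℕ) : (n / (n + 1) : ℝ) < 1 := by
    rw [div_lt_one (by positivity)]; linarith
  have hlt (n : ℕ) {u : ℂ} (hu : ‖u‖ ≤ 1) : ‖((n / (n + 1) : ℝ) : ℂ) * u‖ < 1 := by
    rw [norm_mul, Complex.norm_real, Real.norm_of_nonneg (by positivity)]
    exact lt_of_le_of_lt (mul_le_of_le_one_right (by positivity) hu) (hr1 n)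
  have hex (n : ℕ) := exists_eq_discCauchy_of_diffContOnCl
    (G := fun u => F (((n / (n + 1) : ℝ) : ℂ) * u)) (by
      refine DifferentiableOn.diffContOnCl ?_
      rw [closure_ball (0 : ℂ) one_ne_zero]
      exact hF.comp (by fun_prop) fun u hu => by
        simpa using hlt n (by simpa using hu)) (by simp [hF0])
    (fun w hw => hre _ (hlt n hw.le))
  choose ν hν hνF using hex
  refine exists_eq_discCauchy_of_tendsto hν fun u hu => ?_
  simp only [← hνF _ u hu]
  refine ((hF.differentiableAt (Metric.isOpen_ball.mem_nhds (by simpa using hu))).continuousAt.tendsto).comp ?_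
  have h1 : Tendsto (fun n : ℕ => (((n / (n + 1) : ℝ)) : ℂ)) atTop (𝓝 ((1 : ℝ) : ℂ)) :=
    (Complex.continuous_ofReal.tendsto _).comp (tendsto_natCast_div_add_atTop 1)
  simpa using h1.mul_const u

/-! ### Reversed polynomials -/

theorem coeff_starReverse (m : ℕ) (P : ℂ[X]) (i : ℕ) :
    (starReverse m P).coeff i = conj (P.coeff (revAt m i)) := by
  simp [starReverse]

theorem natDegree_starReverse_le {m : ℕ} {P : ℂ[X]} (hP : P.natDegree ≤ m) :
    (starReverse m P).natDegree ≤ m := by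
  rw [natDegree_le_iff_coeff_eq_zero]
  intro i hi
  rw [coeff_starReverse, revAt_eq_self_of_lt hi, coeff_eq_zero_of_natDegree_lt (by omega), map_zero]

@[simp] theorem starReverse_starReverse (m : ℕ) (P : ℂ[X]) :
    starReverse m (starReverse m P) = P := by
  ext i
  simp [coeff_starReverse]

theorem starReverse_sub (m : ℕ) (P Q : ℂ[X]) :
    starReverse m (P - Q) = starReverse m P - starReverse m Q := by
  ext i
  simp [coeff_starReverse]

theorem starReverse_C_mul (m : ℕ) (c : ℂ) (P : ℂ[X]) :
    starReverse m (C c * P) = C (conj c) * starReverse m P := by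
  ext i
  simp [coeff_starReverse]

theorem starReverse_succ_X_mul {m : ℕ} {P : ℂ[X]} (hP : P.natDegree ≤ m) :
    starReverse (m + 1) (X * P) = starReverse m P := by
  ext i
  rw [coeff_starReverse, coeff_starReverse]
  -- `revAt m` fixes every index above `m`, so the indices from `m + 1` on are settled by the degree
  -- bound.
  rcases lt_trichotomy i (m + 1) with hi | rfl | hi
  · rw [revAt_le hi.le, revAt_le (by omega), show m + 1 - i = m - i + 1 by omega, coeff_X_mul]
  · rw [revAt_le le_rfl, revAt_eq_self_of_lt (by omega), Nat.sub_self, coeff_X_mul_zero,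
      coeff_eq_zero_of_natDegree_lt (by omega)]
  · obtain ⟨j, rfl⟩ : ∃ j, i = j + 1 := ⟨i - 1, by omega⟩
    rw [revAt_eq_self_of_lt hi, revAt_eq_self_of_lt (by omega), coeff_X_mul,
      coeff_eq_zero_of_natDegree_lt (by omega), coeff_eq_zero_of_natDegree_lt (by omega)]

theorem starReverse_succ_starReverse {m : ℕ} {P : ℂ[X]} (hP : P.natDegree ≤ m) :
    starReverse (m + 1) (starReverse m P) = X * P := by
  rw [← starReverse_succ_X_mul hP, starReverse_starReverse]

theorem eval_starReverse {m : ℕ} {P : ℂ[X]} (hP : P.natDegree ≤ m) {z : ℂ} (hz : z ≠ 0) :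
    (starReverse m P).eval z = z ^ m * conj (P.eval (conj z)⁻¹) := by
  rw [eval_eq_sum_range' (Nat.lt_succ_of_le (natDegree_starReverse_le hP)),
    eval_eq_sum_range' (Nat.lt_succ_of_le hP), map_sum, Finset.mul_sum,
    ← Finset.sum_range_reflect]
  refine Finset.sum_congr rfl fun i hi => ?_
  have hi' : i ≤ m := Nat.lt_succ_iff.1 (Finset.mem_range.1 hi)
  rw [coeff_starReverse, show m + 1 - 1 - i = m - i by omega, revAt_le (Nat.sub_le m i),
    Nat.sub_sub_self hi']
  simp only [map_mul, map_pow, map_inv₀, Complex.conj_conj]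
  rw [← Nat.sub_add_cancel hi', pow_add, Nat.add_sub_cancel]
  have h1 : z ^ i * z⁻¹ ^ i = 1 := by rw [← mul_pow, mul_inv_cancel₀ hz, one_pow]
  linear_combination (-conj (P.coeff i) * z ^ (m - i)) * h1

theorem eval_starReverse_of_norm_eq_one {m : ℕ} {P : ℂ[X]} (hP : P.natDegree ≤ m) {w : ℂ}
    (hw : ‖w‖ = 1) : (starReverse m P).eval w = w ^ m * conj (P.eval w) := by
  have hw0 : w ≠ 0 := by rintro rfl; simp at hw
  rw [eval_starReverse hP hw0, ← Complex.inv_eq_conj hw, inv_inv]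

/-! ### The Szegő recursion -/

/-- The monic polynomials generated by the Szegő recursion with Verblunsky coefficients `α`. -/
def szegoPoly (α : ℕ → ℂ) : ℕ → ℂ[X]
  | 0 => 1
  | n + 1 => X * szegoPoly α n - C (conj (α n)) * starReverse n (szegoPoly α n)

theorem natDegree_szegoPoly_le (α : ℕ → ℂ) (n : ℕ) : (szegoPoly α n).natDegree ≤ n := by
  induction n with
  | zero => simp [szegoPoly]
  | succ n ih =>
    refine (natDegree_sub_le _ _).trans (max_le ?_ ?_)
    · exact natDegree_mul_le.trans (by rw [natDegree_X]; omega)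
    · exact (natDegree_C_mul_le _ _).trans ((natDegree_starReverse_le ih).trans (Nat.le_succ n))

theorem coeff_szegoPoly_self (α : ℕ → ℂ) (n : ℕ) : (szegoPoly α n).coeff n = 1 := by
  induction n with
  | zero => simp [szegoPoly]
  | succ n ih =>
    rw [szegoPoly, coeff_sub, coeff_X_mul, ih, coeff_C_mul, coeff_eq_zero_of_natDegree_lt
      (Nat.lt_succ_of_le (natDegree_starReverse_le (natDegree_szegoPoly_le α n)))]
    simp

/-- The reversed polynomial `Φ_n^*`. -/
def szegoStar (α : ℕ → ℂ) (n : ℕ) : ℂ[X] := starReverse n (szegoPoly α n)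

theorem szegoPoly_succ (α : ℕ → ℂ) (n : ℕ) :
    szegoPoly α (n + 1) = X * szegoPoly α n - C (conj (α n)) * szegoStar α n := rfl

theorem szegoStar_zero (α : ℕ → ℂ) : szegoStar α 0 = 1 := by
  ext i
  rcases i with _ | i
  · simp [szegoStar, szegoPoly, coeff_starReverse]
  · simp [szegoStar, szegoPoly, coeff_starReverse, coeff_one, revAt_eq_self_of_lt]

theorem szegoStar_succ (α : ℕ → ℂ) (n : ℕ) :
    szegoStar α (n + 1) = szegoStar α n - C (α n) * (X * szegoPoly α n) := by
  have h := natDegree_szegoPoly_le α n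
  rw [szegoStar, szegoPoly, starReverse_sub, starReverse_succ_X_mul h, starReverse_C_mul,
    starReverse_succ_starReverse h, Complex.conj_conj, szegoStar]

theorem natDegree_szegoStar_le (α : ℕ → ℂ) (n : ℕ) : (szegoStar α n).natDegree ≤ n :=
  natDegree_starReverse_le (natDegree_szegoPoly_le α n)

/-- A Szegő step multiplies the form `|y|² - |x|²` by `1 - |a|²`, where `x = u Φ_n(u)` and `y =
Φ_n^*(u)`. Hence `|x| ≤ |y|` survives the recursion. -/
theorem normSq_szego_sub (a x y : ℂ) :
    Complex.normSq (y - a * x) - Complex.normSq (x - conj a * y) =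
      (1 - Complex.normSq a) * (Complex.normSq y - Complex.normSq x) := by
  simp only [Complex.normSq_apply, Complex.sub_re, Complex.sub_im, Complex.mul_re,
    Complex.mul_im, Complex.conj_re, Complex.conj_im]
  ring

theorem norm_szego_le {a x y : ℂ} (ha : ‖a‖ < 1) (hxy : ‖x‖ ≤ ‖y‖) :
    ‖x - conj a * y‖ ≤ ‖y - a * x‖ := by
  have h := normSq_szego_sub a x y
  simp only [Complex.normSq_eq_norm_sq] at h
  refine (sq_le_sq₀ (norm_nonneg _) (norm_nonneg _)).1 (sub_nonneg.1 (h ▸ ?_))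
  exact mul_nonneg (by nlinarith [norm_nonneg a]) (by nlinarith [norm_nonneg x])

theorem szego_sub_ne_zero {a x y : ℂ} (ha : ‖a‖ < 1) (hxy : ‖x‖ ≤ ‖y‖) (hy : y ≠ 0) :
    y - a * x ≠ 0 := by
  intro h
  have h1 : ‖y‖ = ‖a‖ * ‖x‖ := by rw [sub_eq_zero.1 h, norm_mul]
  have h2 : 0 < ‖y‖ := norm_pos_iff.2 hy
  nlinarith [norm_nonneg a]

/-- This makes `Φ_n / Φ_n^*` well defined and bounded by `1` on the closed disc. The two claims need
each other in the induction. -/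
theorem szegoStar_bounds {α : ℕ → ℂ} (hα : ∀ n, ‖α n‖ < 1) (n : ℕ) {u : ℂ} (hu : ‖u‖ ≤ 1) :
    (szegoStar α n).eval u ≠ 0 ∧ ‖(szegoPoly α n).eval u‖ ≤ ‖(szegoStar α n).eval u‖ := by
  induction n with
  | zero => simp [szegoStar_zero, szegoPoly]
  | succ n ih =>
    have h : ‖u * (szegoPoly α n).eval u‖ ≤ ‖(szegoStar α n).eval u‖ := by
      rw [norm_mul]
      exact (mul_le_of_le_one_left (norm_nonneg _) hu).trans ih.2
    rw [szegoStar_succ, szegoPoly_succ]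
    simp only [eval_sub, eval_mul, eval_C, eval_X]
    exact ⟨szego_sub_ne_zero (hα n) h ih.1, norm_szego_le (hα n) h⟩

/-- The iterates of the inverse Schur algorithm at the point `u`, started at `h`. -/
def schurIter (α : ℕ → ℂ) (u h : ℂ) : ℕ → ℂ
  | 0 => h
  | n + 1 => (u * schurIter α u h n - conj (α n)) / (1 - α n * (u * schurIter α u h n))

/-- Dividing the recursion for `Φ_n` by that for `Φ_n^*` gives the Möbius recursion of `schurIter`;
the start is `1` because `Φ_0 = Φ_0^* = 1`. -/
theorem schurIter_one {α : ℕ → ℂ} (hα : ∀ n, ‖α n‖ < 1) (n : ℕ) {u : ℂ} (hu : ‖u‖ ≤ 1) :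
    schurIter α u 1 n = (szegoPoly α n).eval u / (szegoStar α n).eval u := by
  induction n with
  | zero => simp [schurIter, szegoPoly, szegoStar_zero]
  | succ n ih =>
    have h0 := (szegoStar_bounds hα n hu).1
    have h1 := (szegoStar_bounds hα (n + 1) hu).1
    rw [schurIter, ih]
    rw [szegoStar_succ] at h1 ⊢
    rw [szegoPoly_succ]
    simp only [eval_sub, eval_mul, eval_C, eval_X] at h1 ⊢
    have h2 : 1 - α n * (u * ((szegoPoly α n).eval u / (szegoStar α n).eval u)) ≠ 0 := by
      intro h
      apply h1
      field_simp at h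
      linear_combination h
    field_simp

theorem norm_conj_inv_lt_one {z : ℂ} (hz : 1 < ‖z‖) : ‖(conj z)⁻¹‖ < 1 := by
  rw [norm_inv, RCLike.norm_conj]
  exact inv_lt_one_of_one_lt₀ hz

/-- The ratio of an orthogonal and a paraorthogonal polynomial, in terms of the Schur iterates. -/
theorem monicOP_div_paraOP {μ : Measure ℂ} {α : ℕ → ℂ} (hα : ∀ n, ‖α n‖ < 1)
    (h : ∀ n, monicOP μ n = szegoPoly α n) (n : ℕ) {z : ℂ} (hz : 1 < ‖z‖) :
    (monicOP μ n).eval z / (paraOP μ (n + 1)).eval z =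
      conj ((conj z)⁻¹ / (1 + (conj z)⁻¹ * schurIter α (conj z)⁻¹ 1 n)) := by
  have hu := norm_conj_inv_lt_one hz
  have hz0 : z ≠ 0 := by rintro rfl; simp at hz; linarith
  -- Reflection in the circle exchanges `Φ_n` and `Φ_n^*`, moving the evaluation point into the
  -- disc.
  have h1 : (szegoPoly α n).eval z = z ^ n * conj ((szegoStar α n).eval (conj z)⁻¹) := by
    rw [← eval_starReverse (natDegree_szegoStar_le α n) hz0, szegoStar, starReverse_starReverse]
  have h2 : (starReverse n (szegoPoly α n)).eval z =
      z ^ n * conj ((szegoPoly α n).eval (conj z)⁻¹) :=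
    eval_starReverse (natDegree_szegoPoly_le α n) hz0
  have h3 := (szegoStar_bounds hα n hu.le).1
  have h4 : conj ((szegoStar α n).eval (conj z)⁻¹) ≠ 0 := (_root_.map_ne_zero _).2 h3
  rw [paraOP, Nat.add_sub_cancel, h n, eval_add, eval_mul, eval_X, h1, h2,
    schurIter_one hα n hu.le]
  simp only [map_div₀, map_add, map_mul, map_inv₀, Complex.conj_conj, map_one]
  generalize conj ((szegoStar α n).eval (conj z)⁻¹) = a at h4 ⊢
  generalize conj ((szegoPoly α n).eval (conj z)⁻¹) = b
  have h5 : 1 + z⁻¹ * (b / a) = (z * a + b) / (z * a) := by field_simp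
  rw [h5, div_div_eq_mul_div, inv_mul_cancel_left₀ hz0, mul_left_comm, ← mul_add,
    mul_div_mul_left _ _ (pow_ne_zero n hz0)]

/-! ### The inner product on polynomials -/

theorem IsCircleProbability.integrable_inner {μ : Measure ℂ} (hμ : IsCircleProbability μ)
    (P Q : ℂ[X]) : Integrable (fun w => conj (P.eval w) * Q.eval w) μ :=
  hμ.integrable (by fun_prop)

theorem polyInner_add {μ : Measure ℂ} (hμ : IsCircleProbability μ) (P Q R : ℂ[X]) :
    polyInner μ P (Q + R) = polyInner μ P Q + polyInner μ P R := by
  simp only [polyInner, eval_add, mul_add]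
  exact integral_add (hμ.integrable_inner P Q) (hμ.integrable_inner P R)

theorem polyInner_sub {μ : Measure ℂ} (hμ : IsCircleProbability μ) (P Q R : ℂ[X]) :
    polyInner μ P (Q - R) = polyInner μ P Q - polyInner μ P R := by
  simp only [polyInner, eval_sub, mul_sub]
  exact integral_sub (hμ.integrable_inner P Q) (hμ.integrable_inner P R)

theorem polyInner_sum {μ : Measure ℂ} (hμ : IsCircleProbability μ) {ι : Type*} (s : Finset ι)
    (P : ℂ[X]) (Q : ι → ℂ[X]) :
    polyInner μ P (∑ i ∈ s, Q i) = ∑ i ∈ s, polyInner μ P (Q i) := by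
  simp only [polyInner, eval_finsetSum, Finset.mul_sum]
  exact integral_finsetSum _ fun i _ => hμ.integrable_inner P (Q i)

theorem polyInner_C_mul (μ : Measure ℂ) (P : ℂ[X]) (c : ℂ) (Q : ℂ[X]) :
    polyInner μ P (C c * Q) = c * polyInner μ P Q := by
  simp only [polyInner, eval_mul, eval_C, mul_left_comm _ c]
  exact integral_const_mul _ _

theorem conj_polyInner (μ : Measure ℂ) (P Q : ℂ[X]) :
    conj (polyInner μ P Q) = polyInner μ Q P := by
  simp only [polyInner, ← integral_conj, map_mul, Complex.conj_conj, mul_comm]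

theorem polyInner_comm_zero {μ : Measure ℂ} {P Q : ℂ[X]} (h : polyInner μ P Q = 0) :
    polyInner μ Q P = 0 := by
  rw [← conj_polyInner, h, map_zero]

theorem conj_mul_self_of_norm_eq_one {w : ℂ} (hw : ‖w‖ = 1) : conj w * w = 1 := by
  rw [Complex.conj_mul', hw]; norm_num

theorem polyInner_X_mul_X_mul {μ : Measure ℂ} (hμ : IsCircleProbability μ) (P Q : ℂ[X]) :
    polyInner μ (X * P) (X * Q) = polyInner μ P Q := by
  refine hμ.integral_congr fun w hw => ?_
  simp only [eval_mul, eval_X, map_mul]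
  linear_combination (conj (P.eval w) * Q.eval w) * conj_mul_self_of_norm_eq_one hw

theorem polyInner_starReverse_starReverse {μ : Measure ℂ} (hμ : IsCircleProbability μ) {n : ℕ}
    {P Q : ℂ[X]} (hP : P.natDegree ≤ n) (hQ : Q.natDegree ≤ n) :
    polyInner μ (starReverse n P) (starReverse n Q) = polyInner μ Q P := by
  refine hμ.integral_congr fun w hw => ?_
  have h : conj w ^ n * w ^ n = 1 := by
    rw [← mul_pow, conj_mul_self_of_norm_eq_one hw, one_pow]
  simp only [eval_starReverse_of_norm_eq_one, hP, hQ, hw, map_mul, map_pow, Complex.conj_conj]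
  linear_combination (conj (Q.eval w) * P.eval w) * h

/-- On the circle `P^*` is `w ^ n * conj (P w)`. Thus, if `P` is orthogonal to `1, …, X ^ (n - 1)`,
then `P^*` is orthogonal to `X, …, X ^ n`. -/
theorem polyInner_X_pow_starReverse {μ : Measure ℂ} (hμ : IsCircleProbability μ) {n k : ℕ}
    {P : ℂ[X]} (hP : P.natDegree ≤ n) (hk : k ≤ n) :
    polyInner μ (X ^ k) (starReverse n P) = polyInner μ P (X ^ (n - k)) := by
  refine hμ.integral_congr fun w hw => ?_
  have h : conj w ^ k * w ^ k = 1 := by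
    rw [← mul_pow, conj_mul_self_of_norm_eq_one hw, one_pow]
  rw [eval_starReverse_of_norm_eq_one hP hw]
  nth_rw 1 [← Nat.sub_add_cancel hk]
  simp only [eval_pow, eval_X, pow_add, map_pow]
  linear_combination (conj (P.eval w) * w ^ (n - k)) * h

/-- The squared `L²` norm of a polynomial. -/
def polyNormSq (μ : Measure ℂ) (P : ℂ[X]) : ℝ := ∫ w, ‖P.eval w‖ ^ 2 ∂μ

theorem polyInner_self (μ : Measure ℂ) (P : ℂ[X]) : polyInner μ P P = (polyNormSq μ P : ℂ) := by
  rw [polyNormSq, ← integral_complex_ofReal, polyInner]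
  simp only [Complex.conj_mul', Complex.ofReal_pow]

theorem polyNormSq_nonneg (μ : Measure ℂ) (P : ℂ[X]) : 0 ≤ polyNormSq μ P :=
  integral_nonneg fun _ => sq_nonneg _

/-- A polynomial of norm zero vanishes on the support, which would then lie in its finite root set.
-/
theorem polyNormSq_pos {μ : Measure ℂ} (hμ : IsCircleProbability μ) (hinf : μ.support.Infinite)
    {P : ℂ[X]} (hP : P ≠ 0) : 0 < polyNormSq μ P := by
  refine (polyNormSq_nonneg μ P).lt_of_ne' fun h => hinf ?_
  refine (P.roots.toFinset.finite_toSet).subset ?_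
  have hae : ∀ᵐ w ∂μ, w ∈ {w | P.eval w = 0} := by
    have h1 := (integral_eq_zero_iff_of_nonneg (μ := μ) (fun w => sq_nonneg ‖P.eval w‖)
      (hμ.integrable (by fun_prop))).1 h
    filter_upwards [h1] with w hw
    simpa using hw
  refine (Measure.support_subset_of_isClosed (isClosed_eq P.continuous continuous_const) hae).trans
    fun w hw => ?_
  simpa [hP] using hw

/-! ### Orthogonality -/

/-- `P` is orthogonal to `1, X, …, X ^ (n - 1)`. -/
def OrthBelow (μ : Measure ℂ) (n : ℕ) (P : ℂ[X]) : Prop :=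
  ∀ k < n, polyInner μ (X ^ k) P = 0

theorem OrthBelow.polyInner_eq_zero {μ : Measure ℂ} (hμ : IsCircleProbability μ) {n : ℕ}
    {P Q : ℂ[X]} (hP : OrthBelow μ n P) (hQ : ∀ i, n ≤ i → Q.coeff i = 0) :
    polyInner μ P Q = 0 := by
  have h : Q = ∑ i ∈ Finset.range n, C (Q.coeff i) * X ^ i := by
    ext i
    by_cases hi : i < n
    · simp [hi]
    · simp [hi, hQ i (not_lt.1 hi)]
  rw [h, polyInner_sum hμ]
  refine Finset.sum_eq_zero fun i hi => ?_
  rw [polyInner_C_mul, polyInner_comm_zero (hP i (Finset.mem_range.1 hi)), mul_zero]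

theorem coeff_sub_eq_zero_of_monic {n : ℕ} {P Q : ℂ[X]} (hP : P.natDegree ≤ n)
    (hQ : Q.natDegree ≤ n) (hP1 : P.coeff n = 1) (hQ1 : Q.coeff n = 1) (i : ℕ) (hi : n ≤ i) :
    (P - Q).coeff i = 0 := by
  rw [coeff_sub]
  rcases hi.eq_or_lt with rfl | hi
  · rw [hP1, hQ1, sub_self]
  · rw [coeff_eq_zero_of_natDegree_lt (hP.trans_lt hi),
      coeff_eq_zero_of_natDegree_lt (hQ.trans_lt hi), sub_self]

/-- Uniqueness of the monic orthogonal polynomial of degree `n`. -/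
theorem OrthBelow.eq_of_monic {μ : Measure ℂ} (hμ : IsCircleProbability μ)
    (hinf : μ.support.Infinite) {n : ℕ} {P Q : ℂ[X]} (hP : OrthBelow μ n P)
    (hQ : OrthBelow μ n Q) (hPn : P.natDegree ≤ n) (hQn : Q.natDegree ≤ n)
    (hP1 : P.coeff n = 1) (hQ1 : Q.coeff n = 1) : P = Q := by
  by_contra hne
  have hco := coeff_sub_eq_zero_of_monic hPn hQn hP1 hQ1
  have h : polyInner μ (P - Q) (P - Q) = 0 := by
    rw [polyInner_sub hμ, polyInner_comm_zero (hP.polyInner_eq_zero hμ hco),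
      polyInner_comm_zero (hQ.polyInner_eq_zero hμ hco), sub_zero]
  rw [polyInner_self] at h
  exact (polyNormSq_pos hμ hinf (sub_ne_zero.2 hne)).ne' (by exact_mod_cast h)

theorem natDegree_monicOP_le (μ : Measure ℂ) (n : ℕ) : (monicOP μ n).natDegree ≤ n := by
  induction n using Nat.strong_induction_on with
  | _ n ih =>
    rw [monicOP]
    refine (natDegree_sub_le _ _).trans (max_le (natDegree_X_pow_le n) ?_)
    exact natDegree_sum_le_of_forall_le _ _ fun j _ =>
      (natDegree_C_mul_le _ _).trans ((ih j j.2).trans j.2.le)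

theorem coeff_monicOP_self (μ : Measure ℂ) (n : ℕ) : (monicOP μ n).coeff n = 1 := by
  rw [monicOP, coeff_sub, coeff_X_pow_self, finsetSum_coeff, Finset.sum_eq_zero, sub_zero]
  intro j _
  rw [coeff_C_mul, coeff_eq_zero_of_natDegree_lt ((natDegree_monicOP_le μ j).trans_lt j.2),
    mul_zero]

theorem monicOP_ne_zero (μ : Measure ℂ) (n : ℕ) : monicOP μ n ≠ 0 := by
  intro h
  simpa [h] using coeff_monicOP_self μ n

theorem polyInner_monicOP_of_lt {μ : Measure ℂ} (hμ : IsCircleProbability μ)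
    (hinf : μ.support.Infinite) (n : ℕ) :
    ∀ j < n, polyInner μ (monicOP μ j) (monicOP μ n) = 0 := by
  induction n using Nat.strong_induction_on with
  | _ n ih =>
    intro j hj
    rw [monicOP.eq_1 μ n, polyInner_sub hμ, polyInner_sum hμ, Finset.sum_eq_single ⟨j, hj⟩]
    · rw [polyInner_C_mul, div_mul_cancel₀, sub_self]
      rw [polyInner_self]
      exact_mod_cast (polyNormSq_pos hμ hinf (monicOP_ne_zero μ j)).ne'
    · intro i _ hij
      rw [polyInner_C_mul]
      rcases lt_trichotomy i.1 j with h | h | h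
      · rw [polyInner_comm_zero (ih j hj i h), mul_zero]
      · exact absurd (Fin.ext h) hij
      · rw [ih i i.2 j h, mul_zero]
    · simp

theorem orthBelow_monicOP {μ : Measure ℂ} (hμ : IsCircleProbability μ)
    (hinf : μ.support.Infinite) (n : ℕ) : OrthBelow μ n (monicOP μ n) := by
  intro k hk
  have h := monicOP.eq_1 μ k
  rw [eq_sub_iff_add_eq] at h
  refine polyInner_comm_zero ?_
  rw [← h, polyInner_add hμ, polyInner_sum hμ,
    polyInner_comm_zero (polyInner_monicOP_of_lt hμ hinf n k hk), zero_add]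
  refine Finset.sum_eq_zero fun j _ => ?_
  rw [polyInner_C_mul,
    polyInner_comm_zero (polyInner_monicOP_of_lt hμ hinf n j (j.2.trans hk)), mul_zero]

/-- The norms in the Szegő recursion. -/
theorem polyNormSq_szego_step {μ : Measure ℂ} (hμ : IsCircleProbability μ) {n : ℕ} {P : ℂ[X]}
    (hP : P.natDegree ≤ n) {c : ℂ} (h : OrthBelow μ (n + 1) (X * P - C c * starReverse n P)) :
    polyNormSq μ (X * P - C c * starReverse n P) = (1 - ‖c‖ ^ 2) * polyNormSq μ P := by
  set S := starReverse n P with hS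
  set Q := X * P - C c * S with hQ
  -- Pythagoras for `X * P = Q + c S` with `Q ⊥ S`, where `X * P`, `P` and `S` have equal norms.
  have hQS : polyInner μ Q S = 0 := h.polyInner_eq_zero hμ fun i hi =>
    coeff_eq_zero_of_natDegree_lt (lt_of_le_of_lt (natDegree_starReverse_le hP) hi)
  have hX : X * P = Q + C c * S := by rw [hQ]; ring
  have hSS : polyInner μ S S = polyInner μ P P := polyInner_starReverse_starReverse hμ hP hP
  have h1 : polyInner μ Q (X * P) = polyInner μ Q Q := by
    rw [hX, polyInner_add hμ, polyInner_C_mul, hQS, mul_zero, add_zero]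
  have h2 : polyInner μ S (X * P) = c * polyInner μ P P := by
    rw [hX, polyInner_add hμ, polyInner_C_mul, polyInner_comm_zero hQS, zero_add, hSS]
  have h3 : polyInner μ P P = polyInner μ Q Q + c * conj c * polyInner μ P P := by
    rw [← polyInner_X_mul_X_mul hμ P P]
    nth_rw 2 [hX]
    rw [polyInner_add hμ, polyInner_C_mul, ← conj_polyInner μ Q, h1, conj_polyInner,
      ← conj_polyInner μ S, h2, map_mul, conj_polyInner, polyInner_X_mul_X_mul hμ]
    ring
  rw [polyInner_self, polyInner_self, Complex.mul_conj'] at h3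
  have h4 : polyNormSq μ P = polyNormSq μ Q + ‖c‖ ^ 2 * polyNormSq μ P := by exact_mod_cast h3
  linarith

/-- Both `X Φ_n` and `Φ_n^*` are orthogonal to `X, …, X ^ n`, so one multiple of `Φ_n^*` has to be
subtracted to achieve orthogonality to `1`. Uniqueness identifies the result with `Φ_{n+1}`, and
positivity of its norm bounds the coefficient. -/
theorem exists_szego_step {μ : Measure ℂ} (hμ : IsCircleProbability μ)
    (hinf : μ.support.Infinite) (n : ℕ) :
    ∃ a : ℂ, ‖a‖ < 1 ∧ monicOP μ (n + 1) =
      X * monicOP μ n - C (conj a) * starReverse n (monicOP μ n) := by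
  set P := monicOP μ n with hP
  have hPn : P.natDegree ≤ n := natDegree_monicOP_le μ n
  have hPo : OrthBelow μ n P := orthBelow_monicOP hμ hinf n
  have hpos : 0 < polyNormSq μ P := polyNormSq_pos hμ hinf (monicOP_ne_zero μ n)
  have hS0 : polyInner μ (X ^ 0) (starReverse n P) = (polyNormSq μ P : ℂ) := by
    rw [polyInner_X_pow_starReverse hμ hPn (Nat.zero_le n), Nat.sub_zero, ← polyInner_self,
      ← sub_eq_zero, ← polyInner_sub hμ]
    exact hPo.polyInner_eq_zero hμ (coeff_sub_eq_zero_of_monic (natDegree_X_pow_le n) hPn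
      (coeff_X_pow_self n) (coeff_monicOP_self μ n))
  set c : ℂ := polyInner μ (X ^ 0) (X * P) / (polyNormSq μ P : ℂ) with hc
  have hQo : OrthBelow μ (n + 1) (X * P - C c * starReverse n P) := by
    intro k hk
    rw [polyInner_sub hμ, polyInner_C_mul]
    rcases k with _ | k
    · rw [hS0, hc, div_mul_cancel₀ _ (by exact_mod_cast hpos.ne'), sub_self]
    · rw [polyInner_X_pow_starReverse hμ hPn (by omega), pow_succ', polyInner_X_mul_X_mul hμ,
        hPo k (by omega), polyInner_comm_zero (hPo _ (by omega)), mul_zero, sub_zero]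
  have hQn : (X * P - C c * starReverse n P).natDegree ≤ n + 1 := by
    refine (natDegree_sub_le _ _).trans (max_le ?_ ?_)
    · exact natDegree_mul_le.trans (by rw [natDegree_X]; omega)
    · exact (natDegree_C_mul_le _ _).trans ((natDegree_starReverse_le hPn).trans (Nat.le_succ n))
  have hQ1 : (X * P - C c * starReverse n P).coeff (n + 1) = 1 := by
    rw [coeff_sub, coeff_X_mul, coeff_monicOP_self, coeff_C_mul, coeff_eq_zero_of_natDegree_lt
      (Nat.lt_succ_of_le (natDegree_starReverse_le hPn)), mul_zero, sub_zero]
  have hnorm := polyNormSq_szego_step hμ hPn hQo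
  have hQpos : 0 < polyNormSq μ (X * P - C c * starReverse n P) :=
    polyNormSq_pos hμ hinf fun h => by simp [h] at hQ1
  refine ⟨conj c, ?_, ?_⟩
  · rw [RCLike.norm_conj]
    rw [hnorm] at hQpos
    have h1 : 0 < 1 - ‖c‖ ^ 2 := pos_of_mul_pos_left hQpos hpos.le
    nlinarith [norm_nonneg c]
  · rw [Complex.conj_conj]
    exact (orthBelow_monicOP hμ hinf (n + 1)).eq_of_monic hμ hinf hQo
      (natDegree_monicOP_le μ _) hQn (coeff_monicOP_self μ _) hQ1

/-- The orthogonal polynomials satisfy the Szegő recursion. -/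
theorem exists_monicOP_eq_szegoPoly {μ : Measure ℂ} (hμ : IsCircleProbability μ)
    (hinf : μ.support.Infinite) :
    ∃ α : ℕ → ℂ, (∀ n, ‖α n‖ < 1) ∧ ∀ n, monicOP μ n = szegoPoly α n := by
  choose α hα h using exists_szego_step hμ hinf
  refine ⟨α, hα, fun n => ?_⟩
  induction n with
  | zero => rw [monicOP]; simp [szegoPoly]
  | succ n ih => rw [h, ih, szegoPoly]

/-! ### Verblunsky's theorem -/

theorem circleAverage_pos {D : ℂ → ℝ} (hD : ContinuousOn D (Metric.sphere 0 1))
    (hpos : ∀ w, ‖w‖ = 1 → 0 < D w) : 0 < Real.circleAverage D 0 1 := by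
  obtain ⟨w₀, hw₀, hmin⟩ := (isCompact_sphere (0 : ℂ) 1).exists_isMinOn ⟨1, by simp⟩ hD
  have h := Real.circleAverage_mono (c := 0) (R := 1)
    (continuousOn_const (c := D w₀) |>.circleIntegrable zero_le_one)
    (hD.circleIntegrable zero_le_one) (fun w hw => hmin (by simpa using hw))
  rw [Real.circleAverage_const] at h
  exact (hpos w₀ (by simpa using hw₀)).trans_le h

theorem szegoPoly_eval_ne_zero {α : ℕ → ℂ} (hα : ∀ n, ‖α n‖ < 1) (n : ℕ) {w : ℂ}
    (hw : ‖w‖ = 1) : (szegoPoly α n).eval w ≠ 0 := by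
  intro h
  refine (szegoStar_bounds hα n hw.le).1 ?_
  rw [szegoStar, eval_starReverse_of_norm_eq_one (natDegree_szegoPoly_le α n) hw, h]
  simp

/-- The Bernstein-Szegő measure, with density proportional to `1 / |Φ_n|²`. -/
theorem exists_orthBelow_szegoPoly {α : ℕ → ℂ} (hα : ∀ n, ‖α n‖ < 1) (n : ℕ) :
    ∃ μ, IsCircleProbability μ ∧ OrthBelow μ n (szegoPoly α n) := by
  set P := szegoPoly α n with hP
  have hne (w : ℂ) (hw : ‖w‖ = 1) : P.eval w ≠ 0 := szegoPoly_eval_ne_zero hα n hw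
  have hDc : ContinuousOn (fun w => (‖P.eval w‖ ^ 2)⁻¹) (Metric.sphere 0 1) :=
    ContinuousOn.inv₀ (by fun_prop) fun w hw =>
      pow_ne_zero 2 (norm_ne_zero_iff.2 (hne w (by simpa using hw)))
  have hDpos (w : ℂ) (hw : ‖w‖ = 1) : 0 < (‖P.eval w‖ ^ 2)⁻¹ :=
    inv_pos.2 (pow_pos (norm_pos_iff.2 (hne w hw)) 2)
  have hc := circleAverage_pos hDc hDpos
  set c := Real.circleAverage (fun w => (‖P.eval w‖ ^ 2)⁻¹) 0 1 with hcdef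
  obtain ⟨μ, hμ, hint⟩ := exists_isCircleProbability_density
    (D := fun w => c⁻¹ • (‖P.eval w‖ ^ 2)⁻¹) (hDc.const_smul c⁻¹)
    (fun w hw => (mul_pos (inv_pos.2 hc) (hDpos w hw)).le)
    (by rw [Real.circleAverage_fun_smul, ← hcdef, smul_eq_mul, inv_mul_cancel₀ hc.ne'])
  refine ⟨μ, hμ, fun k hk => ?_⟩
  rw [polyInner, hint _ (by fun_prop)]
  -- On the circle `conj (w ^ k) * P / |P|² = w ^ (n - k) / Φ_n^*`. This is analytic in the disc
  -- since `Φ_n^*` has no zero there, and it vanishes at `0` since `k < n`.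
  have hA : DiffContOnCl ℂ (fun w => ((szegoStar α n).eval w)⁻¹ * ((c : ℂ)⁻¹ * w ^ (n - k)))
      (Metric.ball 0 1) := by
    refine DiffContOnCl.smul (DiffContOnCl.inv
      (Differentiable.diffContOnCl (szegoStar α n).differentiable) ?_)
      (Differentiable.diffContOnCl (by fun_prop))
    intro w hw
    rw [closure_ball (0 : ℂ) one_ne_zero, mem_closedBall_zero_iff] at hw
    exact (szegoStar_bounds hα n hw).1
  have h0 := DiffContOnCl.circleAverage (R := 1) (c := 0) (by rwa [abs_one])
    (f := fun w => ((szegoStar α n).eval w)⁻¹ * ((c : ℂ)⁻¹ * w ^ (n - k)))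
  refine (Real.circleAverage_congr_sphere fun w hw => ?_).trans (h0.trans ?_)
  · have hw1 : ‖w‖ = 1 := by simpa using hw
    have hw0 : w ≠ 0 := by rintro rfl; simp at hw1
    have hconj : conj (P.eval w) ≠ 0 := (_root_.map_ne_zero _).2 (hne w hw1)
    have hkw : conj w ^ k * w ^ k = 1 := by
      rw [← mul_pow, conj_mul_self_of_norm_eq_one hw1, one_pow]
    have h1 : (szegoStar α n).eval w = w ^ n * conj (P.eval w) :=
      eval_starReverse_of_norm_eq_one (natDegree_szegoPoly_le α n) hw1
    simp only [h1, smul_eq_mul, Complex.ofReal_mul, Complex.ofReal_inv, Complex.ofReal_pow,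
      ← Complex.mul_conj', eval_pow, eval_X, map_pow]
    have h2 : w ^ n = w ^ (n - k) * w ^ k := by rw [← pow_add, Nat.sub_add_cancel hk.le]
    have h3 := hne w hw1
    have h4 : (c : ℂ) ≠ 0 := by exact_mod_cast hc.ne'
    rw [h2]
    field_simp
    linear_combination hkw
  · have : n - k ≠ 0 := by omega
    simp [this]

/-- As `|α n| < 1` the Szegő step can be inverted, expressing `X Φ_n` by `Φ_{n+1}` and `Φ_{n+1}^*`,
both orthogonal to `X, …, X ^ n`. So the Bernstein-Szegő measure of degree `n` serves all lower
degrees. -/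
theorem OrthBelow.szegoPoly_pred {μ : Measure ℂ} (hμ : IsCircleProbability μ) {α : ℕ → ℂ}
    (hα : ∀ n, ‖α n‖ < 1) {n : ℕ} (h : OrthBelow μ (n + 1) (szegoPoly α (n + 1))) :
    OrthBelow μ n (szegoPoly α n) := by
  intro k hk
  have hne : 1 - conj (α n) * α n ≠ 0 := by
    rw [Complex.conj_mul', sub_ne_zero]
    have h1 : ‖α n‖ ^ 2 < 1 := by nlinarith [hα n, norm_nonneg (α n)]
    exact_mod_cast h1.ne'
  have hid : C (1 - conj (α n) * α n) * (X * szegoPoly α n) =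
      szegoPoly α (n + 1) + C (conj (α n)) * szegoStar α (n + 1) := by
    rw [szegoPoly_succ, szegoStar_succ, C_sub, C_mul, C_1]
    ring
  have h2 := congrArg (polyInner μ (X ^ (k + 1))) hid
  rw [polyInner_C_mul, polyInner_add hμ, polyInner_C_mul, pow_succ', polyInner_X_mul_X_mul hμ,
    ← pow_succ', h (k + 1) (by omega), szegoStar,
    polyInner_X_pow_starReverse hμ (natDegree_szegoPoly_le α (n + 1)) (by omega),
    polyInner_comm_zero (h (n + 1 - (k + 1)) (by omega)), mul_zero, add_zero] at h2
  exact (mul_eq_zero.1 h2).resolve_left hne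

/-- Each orthogonality relation is one integral of a continuous function that vanishes for all late
Bernstein-Szegő measures, hence for their weak limit. -/
theorem exists_orthBelow_szegoPoly_forall {α : ℕ → ℂ} (hα : ∀ n, ‖α n‖ < 1) :
    ∃ μ, IsCircleProbability μ ∧ ∀ n, OrthBelow μ n (szegoPoly α n) := by
  choose μ hμ h using exists_orthBelow_szegoPoly hα
  have hle (n j : ℕ) (hj : j ≤ n) : OrthBelow (μ n) j (szegoPoly α j) :=
    Nat.decreasingInduction (motive := fun j _ => OrthBelow (μ n) j (szegoPoly α j))
      (fun _ _ hk => hk.szegoPoly_pred (hμ n) hα) (h n) hj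
  obtain ⟨ν, hν, hlim⟩ := exists_tendsto_hyperfilter hμ
  refine ⟨ν, hν, fun n k hk => tendsto_nhds_unique (hlim _ (by fun_prop)) ?_⟩
  refine tendsto_const_nhds.congr' ?_
  filter_upwards [Nat.hyperfilter_le_atTop (eventually_ge_atTop n)] with m hm
  exact (hle m n hm k hk).symm

/-- The norm is the product of the factors `1 - |α i|²`; infinite support is not yet available and
is deduced from this. -/
theorem polyNormSq_szegoPoly_pos {μ : Measure ℂ} (hμ : IsCircleProbability μ) {α : ℕ → ℂ}
    (hα : ∀ n, ‖α n‖ < 1) (h : ∀ n, OrthBelow μ n (szegoPoly α n)) (n : ℕ) :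
    0 < polyNormSq μ (szegoPoly α n) := by
  induction n with
  | zero =>
    have := hμ.1
    simp [szegoPoly, polyNormSq]
  | succ n ih =>
    rw [szegoPoly, polyNormSq_szego_step hμ (natDegree_szegoPoly_le α n) (h (n + 1)),
      RCLike.norm_conj]
    exact mul_pos (by nlinarith [hα n, norm_nonneg (α n)]) ih

/-- With `m` support points, the monic `Q` of degree `m` vanishing on them is zero in `L²`, yet its
inner product with `Φ_m` is `‖Φ_m‖² > 0`. -/
theorem support_infinite_of_orthBelow_szegoPoly {μ : Measure ℂ} (hμ : IsCircleProbability μ)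
    {α : ℕ → ℂ} (hα : ∀ n, ‖α n‖ < 1) (h : ∀ n, OrthBelow μ n (szegoPoly α n)) :
    μ.support.Infinite := by
  intro hfin
  set Q : ℂ[X] := ∏ w ∈ hfin.toFinset, (X - C w) with hQ
  set m := hfin.toFinset.card with hm
  have hmonic : Q.Monic := monic_prod_X_sub_C _ _
  have hdeg : Q.natDegree = m := natDegree_finsetProd_X_sub_C_eq_card _ fun w => w
  have hQ0 : polyInner μ (szegoPoly α m) Q = 0 := by
    refine integral_eq_zero_of_ae (mem_of_superset Measure.support_mem_ae fun w hw => ?_)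
    have hev : Q.eval w = 0 := by
      rw [hQ, eval_prod]
      exact Finset.prod_eq_zero (hfin.mem_toFinset.2 hw) (by simp)
    simp [hev]
  have hsub := (h m).polyInner_eq_zero hμ (coeff_sub_eq_zero_of_monic
    (natDegree_szegoPoly_le α m) hdeg.le (coeff_szegoPoly_self α m)
    (by rw [← hdeg]; exact hmonic.coeff_natDegree))
  rw [polyInner_sub hμ, hQ0, sub_zero, polyInner_self] at hsub
  exact (polyNormSq_szegoPoly_pos hμ hα h m).ne' (by exact_mod_cast hsub)

/-- Verblunsky's theorem: all coefficients in the open unit disc occur. -/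
theorem exists_monicOP_eq_of_verblunsky {α : ℕ → ℂ} (hα : ∀ n, ‖α n‖ < 1) :
    ∃ μ, IsCircleProbability μ ∧ μ.support.Infinite ∧ ∀ n, monicOP μ n = szegoPoly α n := by
  obtain ⟨μ, hμ, h⟩ := exists_orthBelow_szegoPoly_forall hα
  have hinf := support_infinite_of_orthBelow_szegoPoly hμ hα h
  exact ⟨μ, hμ, hinf, fun n => (orthBelow_monicOP hμ hinf n).eq_of_monic hμ hinf (h n)
    (natDegree_monicOP_le μ n) (natDegree_szegoPoly_le α n) (coeff_monicOP_self μ n)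
    (coeff_szegoPoly_self α n)⟩

/-! ### The Schur algorithm -/

theorem schurIter_congr {α β : ℕ → ℂ} {m : ℕ} (h : ∀ i < m, α i = β i) (u c : ℂ) :
    schurIter α u c m = schurIter β u c m := by
  induction m with
  | zero => rfl
  | succ m ih => rw [schurIter, schurIter, ih fun i hi => h i (by omega), h m (by omega)]

theorem schurIter_add (α : ℕ → ℂ) (u c : ℂ) (n m : ℕ) :
    schurIter α u c (n + m) = schurIter (fun i => α (n + i)) u (schurIter α u c n) m := by
  induction m with
  | zero => rfl
  | succ m ih => rw [← add_assoc, schurIter, schurIter, ih]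

theorem norm_schurIter_le {α : ℕ → ℂ} (hα : ∀ n, ‖α n‖ < 1) {u c : ℂ} (hu : ‖u‖ < 1)
    (hc : ‖c‖ ≤ 1) (n : ℕ) : ‖schurIter α u c n‖ ≤ 1 := by
  induction n with
  | zero => exact hc
  | succ n ih =>
    have h : ‖u * schurIter α u c n‖ ≤ ‖(1 : ℂ)‖ := by
      rw [norm_mul, norm_one]
      exact mul_le_one₀ hu.le (norm_nonneg _) ih
    rw [schurIter, norm_div]
    have h1 := norm_szego_le (hα n) h
    rw [mul_one] at h1
    exact div_le_one_of_le₀ h1 (norm_nonneg _)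

/-- The pseudo-hyperbolic distance is at most `1`. The product form avoids dividing by `1 - conj g *
h`, which may vanish when both points are unimodular. -/
theorem norm_sub_le_norm_one_sub_conj_mul {g h : ℂ} (hg : ‖g‖ ≤ 1) (hh : ‖h‖ ≤ 1) :
    ‖h - g‖ ≤ ‖1 - conj g * h‖ := by
  have h1 : ‖1 - conj g * h‖ ^ 2 - ‖h - g‖ ^ 2 = (1 - ‖h‖ ^ 2) * (1 - ‖g‖ ^ 2) := by
    simp only [← Complex.normSq_eq_norm_sq, Complex.normSq_apply, Complex.sub_re, Complex.sub_im,
      Complex.mul_re, Complex.mul_im, Complex.conj_re, Complex.conj_im, Complex.one_re,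
      Complex.one_im]
    ring
  refine (sq_le_sq₀ (norm_nonneg _) (norm_nonneg _)).1 (sub_nonneg.1 (h1 ▸ ?_))
  exact mul_nonneg (by nlinarith [norm_nonneg h]) (by nlinarith [norm_nonneg g])

/-- The factor by which multiplication by `u` contracts the pseudo-hyperbolic distance. -/
def contractionFactor (u : ℂ) : ℝ := 2 * ‖u‖ / (1 + ‖u‖ ^ 2)

theorem contractionFactor_nonneg (u : ℂ) : 0 ≤ contractionFactor u := by
  unfold contractionFactor; positivity

theorem contractionFactor_lt_one {u : ℂ} (hu : ‖u‖ < 1) : contractionFactor u < 1 := by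
  rw [contractionFactor, div_lt_one (by positivity)]
  nlinarith [sq_pos_of_pos (sub_pos.2 hu)]

/-- The extreme case is `x = -1`, which is where the value of `contractionFactor` comes from. -/
theorem norm_mul_one_sub_le {u x : ℂ} (hu : ‖u‖ < 1) (hx : ‖x‖ ≤ 1) :
    ‖u‖ * ‖1 - x‖ ≤ contractionFactor u * ‖1 - (‖u‖ : ℂ) ^ 2 * x‖ := by
  have h1 : (2 * ‖1 - (‖u‖ : ℂ) ^ 2 * x‖) ^ 2 - ((1 + ‖u‖ ^ 2) * ‖1 - x‖) ^ 2 =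
      (1 - ‖u‖ ^ 2) ^ 2 * ‖1 + x‖ ^ 2 + 2 * (1 + ‖u‖ ^ 2) * (1 - ‖u‖ ^ 2) * (1 - ‖x‖ ^ 2) := by
    have : (‖u‖ : ℂ) ^ 2 = ((‖u‖ ^ 2 : ℝ) : ℂ) := by push_cast; rfl
    rw [this]
    generalize ‖u‖ ^ 2 = r
    simp only [mul_pow, ← Complex.normSq_eq_norm_sq, Complex.normSq_apply, Complex.sub_re,
      Complex.sub_im, Complex.mul_re, Complex.mul_im, Complex.ofReal_re, Complex.ofReal_im,
      Complex.one_re, Complex.one_im, Complex.add_re, Complex.add_im]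
    ring
  have hu2 : 0 ≤ 1 - ‖u‖ ^ 2 := by nlinarith [norm_nonneg u]
  have hx2 : 0 ≤ 1 - ‖x‖ ^ 2 := by nlinarith [norm_nonneg x]
  have h2 : (1 + ‖u‖ ^ 2) * ‖1 - x‖ ≤ 2 * ‖1 - (‖u‖ : ℂ) ^ 2 * x‖ :=
    (sq_le_sq₀ (by positivity) (by positivity)).1 (sub_nonneg.1 (h1 ▸ by positivity))
  rw [contractionFactor, div_mul_eq_mul_div, le_div_iff₀ (by positivity)]
  nlinarith [mul_le_mul_of_nonneg_left h2 (norm_nonneg u)]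

theorem one_sub_mul_ne_zero {a x : ℂ} (ha : ‖a‖ < 1) (hx : ‖x‖ ≤ 1) : 1 - a * x ≠ 0 :=
  szego_sub_ne_zero ha (by simpa using hx) one_ne_zero

/-- One step of the inverse Schur algorithm contracts the pseudo-hyperbolic distance. -/
theorem schurStep_contraction {a u g h : ℂ} {κ : ℝ} (hκ : 0 ≤ κ) (ha : ‖a‖ < 1) (hu : ‖u‖ < 1)
    (hg : ‖g‖ ≤ 1) (hh : ‖h‖ ≤ 1) (hgh : ‖h - g‖ ≤ κ * ‖1 - conj g * h‖) :
    ‖(u * h - conj a) / (1 - a * (u * h)) - (u * g - conj a) / (1 - a * (u * g))‖ ≤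
      κ * contractionFactor u *
        ‖1 - conj ((u * g - conj a) / (1 - a * (u * g))) *
          ((u * h - conj a) / (1 - a * (u * h)))‖ := by
  have hle {x : ℂ} (hx : ‖x‖ ≤ 1) : ‖u * x‖ ≤ 1 := by
    rw [norm_mul]; exact mul_le_one₀ hu.le (norm_nonneg _) hx
  have hA := one_sub_mul_ne_zero ha (hle hh)
  have hB := one_sub_mul_ne_zero ha (hle hg)
  have hB' : 1 - conj a * (conj u * conj g) ≠ 0 := by
    simpa using (_root_.map_ne_zero (starRingEnd ℂ)).2 hB
  -- The Möbius map preserves pseudo-hyperbolic distance: numerator and denominator share the factor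
  -- `1 - |a|²`. Only multiplication by `u` contracts.
  have h1 : (u * h - conj a) / (1 - a * (u * h)) - (u * g - conj a) / (1 - a * (u * g)) =
      (1 - a * conj a) * (u * (h - g)) / ((1 - a * (u * h)) * (1 - a * (u * g))) := by
    rw [div_sub_div _ _ hA hB]
    congr 1
    ring
  have h2 : 1 - conj ((u * g - conj a) / (1 - a * (u * g))) *
      ((u * h - conj a) / (1 - a * (u * h))) =
      (1 - a * conj a) * (1 - (u * conj u) * (conj g * h)) /
        ((1 - a * (u * h)) * conj (1 - a * (u * g))) := by
    simp only [map_div₀, map_sub, map_mul, map_one, Complex.conj_conj]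
    rw [div_mul_div_comm, mul_comm (1 - a * (u * h)), eq_div_iff (mul_ne_zero hB' hA), sub_mul,
      div_mul_cancel₀ _ (mul_ne_zero hB' hA)]
    ring
  rw [h1, h2, Complex.mul_conj' u]
  simp only [norm_div, norm_mul, RCLike.norm_conj]
  rw [mul_div_assoc']
  refine div_le_div_of_nonneg_right ?_ (by positivity)
  have h3 : ‖conj g * h‖ ≤ 1 := by
    rw [norm_mul, RCLike.norm_conj]; exact mul_le_one₀ hg (norm_nonneg _) hh
  have h4 := norm_mul_one_sub_le hu h3
  calc ‖1 - a * conj a‖ * (‖u‖ * ‖h - g‖)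
      ≤ ‖1 - a * conj a‖ * (‖u‖ * (κ * ‖1 - conj g * h‖)) := by gcongr
    _ = ‖1 - a * conj a‖ * κ * (‖u‖ * ‖1 - conj g * h‖) := by ring
    _ ≤ ‖1 - a * conj a‖ * κ *
        (contractionFactor u * ‖1 - (‖u‖ : ℂ) ^ 2 * (conj g * h)‖) := by gcongr
    _ = _ := by ring

/-- Analytic functions on the unit disc bounded by a constant less than `1`. -/
def IsStrictSchur (g : ℂ → ℂ) : Prop :=
  DifferentiableOn ℂ g (Metric.ball 0 1) ∧ ∃ s < 1, ∀ u, ‖u‖ < 1 → ‖g u‖ ≤ s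

/-- One step of the Schur algorithm. -/
theorem IsStrictSchur.exists_step {g : ℂ → ℂ} (hg : IsStrictSchur g) :
    ∃ (a : ℂ) (g₁ : ℂ → ℂ), ‖a‖ < 1 ∧ IsStrictSchur g₁ ∧ ∀ u, ‖u‖ < 1 →
      g u = (u * g₁ u - conj a) / (1 - a * (u * g₁ u)) := by
  obtain ⟨hd, s, hs, hgs⟩ := hg
  set γ := g 0 with hγ
  have hγs : ‖γ‖ ≤ s := hgs 0 (by simp)
  have hs0 : 0 ≤ s := (norm_nonneg _).trans hγs
  -- A Möbius map moves `g 0` to `0`; the next Schur function is `F u / u`, realised by `dslope`.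
  set F : ℂ → ℂ := fun u => (g u - γ) / (1 - conj γ * g u) with hF
  have hden (u : ℂ) (hu : ‖u‖ < 1) : 1 - conj γ * g u ≠ 0 :=
    one_sub_mul_ne_zero (by rw [RCLike.norm_conj]; linarith) ((hgs u hu).trans hs.le)
  have hFd : DifferentiableOn ℂ F (Metric.ball 0 1) :=
    (hd.sub_const γ).div ((differentiableOn_const 1).sub (hd.const_mul _))
      fun u hu => hden u (by simpa using hu)
  have hF0 : F 0 = 0 := by simp [hF, hγ]
  -- From `1 - |F|² = (1 - |γ|²)(1 - |g|²) / |1 - conj γ g|² ≥ t` and `1 - t ≤ (1 - t / 2)²` one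
  -- gets `|F| ≤ 1 - t / 2`, a strict bound that the Schwarz lemma passes to `F u / u`.
  set t : ℝ := (1 - s ^ 2) ^ 2 / 4 with ht
  have hs2 : 0 < 1 - s ^ 2 := by nlinarith
  have ht0 : 0 < t := by positivity
  have ht1 : t ≤ 1 := by rw [ht]; nlinarith [sq_nonneg s]
  have hFs (u : ℂ) (hu : ‖u‖ < 1) : ‖F u‖ ≤ 1 - t / 2 := by
    have hgu := hgs u hu
    have h1 : ‖1 - conj γ * g u‖ ^ 2 - ‖g u - γ‖ ^ 2 = (1 - ‖γ‖ ^ 2) * (1 - ‖g u‖ ^ 2) := by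
      simp only [← Complex.normSq_eq_norm_sq, Complex.normSq_apply, Complex.sub_re,
        Complex.sub_im, Complex.mul_re, Complex.mul_im, Complex.conj_re, Complex.conj_im,
        Complex.one_re, Complex.one_im]
      ring
    have h2 : (1 - s ^ 2) * (1 - s ^ 2) ≤ (1 - ‖γ‖ ^ 2) * (1 - ‖g u‖ ^ 2) :=
      mul_le_mul (by nlinarith [norm_nonneg γ]) (by nlinarith [norm_nonneg (g u)]) hs2.le
        (by nlinarith [norm_nonneg γ])
    have h3 : ‖1 - conj γ * g u‖ ≤ 2 := by
      refine (norm_sub_le _ _).trans ?_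
      rw [norm_one, norm_mul, RCLike.norm_conj]
      nlinarith [norm_nonneg γ, norm_nonneg (g u)]
    have h4 : 0 < ‖1 - conj γ * g u‖ := norm_pos_iff.2 (hden u hu)
    rw [hF, norm_div, div_le_iff₀ h4]
    refine (sq_le_sq₀ (norm_nonneg _) (mul_nonneg (by linarith) h4.le)).1 ?_
    have h5 : ‖1 - conj γ * g u‖ ^ 2 ≤ 4 := by nlinarith
    have h6 : t * ‖1 - conj γ * g u‖ ^ 2 ≤ (1 - s ^ 2) * (1 - s ^ 2) := by
      calc t * ‖1 - conj γ * g u‖ ^ 2 ≤ t * 4 := by gcongr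
        _ = _ := by rw [ht]; ring
    nlinarith [sq_nonneg (t * ‖1 - conj γ * g u‖)]
  have hmaps : Set.MapsTo F (Metric.ball 0 1) (Metric.closedBall (F 0) (1 - t / 2)) := by
    intro u hu
    rw [hF0, mem_closedBall_zero_iff]
    exact hFs u (by simpa using hu)
  refine ⟨-conj γ, dslope F 0, by rw [norm_neg, RCLike.norm_conj]; linarith,
    ⟨(Complex.differentiableOn_dslope (Metric.ball_mem_nhds 0 one_pos)).2 hFd, 1 - t / 2,
      by linarith, fun u hu => ?_⟩, fun u hu => ?_⟩
  · simpa using Complex.norm_dslope_le_div_of_mapsTo_ball hFd hmaps (by simpa using hu)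
  · have h1 : u * dslope F 0 u = F u := by
      have := sub_smul_dslope F 0 u
      simpa [hF0] using this
    have h2 := hden u hu
    have h3 : F u * (1 - conj γ * g u) = g u - γ := by rw [hF]; exact div_mul_cancel₀ _ h2
    have h4 : 1 - -conj γ * F u ≠ 0 :=
      one_sub_mul_ne_zero (by rw [norm_neg, RCLike.norm_conj]; linarith)
        ((hFs u hu).trans (by linarith))
    rw [h1, eq_div_iff h4, map_neg, Complex.conj_conj]
    linear_combination -h3

/-- A strict Schur function is approximated by the inverse Schur algorithm, from any start. -/
theorem IsStrictSchur.exists_approx (m : ℕ) {g : ℂ → ℂ} (hg : IsStrictSchur g) :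
    ∃ β : ℕ → ℂ, (∀ i, ‖β i‖ < 1) ∧ ∀ u c, ‖u‖ < 1 → ‖c‖ ≤ 1 →
      ‖schurIter β u c m - g u‖ ≤
        contractionFactor u ^ m * ‖1 - conj (g u) * schurIter β u c m‖ := by
  induction m generalizing g with
  | zero =>
    refine ⟨fun _ => 0, by simp, fun u c hu hc => ?_⟩
    obtain ⟨-, s, hs, hgs⟩ := hg
    rw [pow_zero, one_mul]
    exact norm_sub_le_norm_one_sub_conj_mul ((hgs u hu).trans hs.le) hc
  | succ m ih =>
    obtain ⟨a, g₁, ha, hg₁, hstep⟩ := hg.exists_step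
    obtain ⟨β, hβ, happ⟩ := ih hg₁
    -- `schurIter` applies its last coefficient outermost, so the first Schur coefficient takes the
    -- last index.
    refine ⟨fun i => if i < m then β i else a, fun i => ?_, fun u c hu hc => ?_⟩
    · dsimp only
      split_ifs
      exacts [hβ i, ha]
    · obtain ⟨-, s, hs, hgs⟩ := hg₁
      rw [schurIter, schurIter_congr (β := β) (fun i hi => if_pos hi), if_neg (lt_irrefl m),
        hstep u hu, pow_succ]
      exact schurStep_contraction (pow_nonneg (contractionFactor_nonneg u) m) ha hu
        ((hgs u hu).trans hs.le) (norm_schurIter_le hβ hu hc m) (happ u c hu hc)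

/-- Every Schur function is a limit of Schur iterates along a subsequence, for coefficients which
are concatenated from blocks approximating it. -/
theorem exists_schurIter_tendsto {g : ℂ → ℂ} (hd : DifferentiableOn ℂ g (Metric.ball 0 1))
    (hg : ∀ u, ‖u‖ < 1 → ‖g u‖ ≤ 1) :
    ∃ α : ℕ → ℂ, (∀ n, ‖α n‖ < 1) ∧ ∃ N : ℕ → ℕ, StrictMono N ∧ (∀ k, 1 ≤ N k) ∧
      ∀ u, ‖u‖ < 1 → Tendsto (fun k => schurIter α u 1 (N k - 1)) atTop (𝓝 (g u)) := by
  -- Scaling by `r k < 1` makes `g` a strict Schur function, so its Schur algorithm never reaches a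
  -- unimodular coefficient.
  set r : ℕ → ℝ := fun k => k / (k + 1) with hr
  have hr0 (k : ℕ) : 0 ≤ r k := by positivity
  have hr1 (k : ℕ) : r k < 1 := by rw [hr, div_lt_one (by positivity)]; linarith
  have hnorm (k : ℕ) (u : ℂ) (hu : ‖u‖ < 1) : ‖(r k : ℂ) * g u‖ ≤ r k := by
    rw [norm_mul, Complex.norm_real, Real.norm_of_nonneg (hr0 k)]
    exact mul_le_of_le_one_right (hr0 k) (hg u hu)
  have hS (k : ℕ) : IsStrictSchur fun u => (r k : ℂ) * g u :=
    ⟨hd.const_mul _, r k, hr1 k, hnorm k⟩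
  choose β hβ happ using fun k => (hS k).exists_approx (2 ^ k)
  -- Block `k` occupies the `2 ^ k` indices with `2 ^ k ≤ n + 1 < 2 ^ (k + 1)`, so it has been fully
  -- applied in the iterate of index `2 ^ (k + 1) - 1`.
  set α : ℕ → ℂ := fun n => β (Nat.log 2 (n + 1)) (n + 1 - 2 ^ Nat.log 2 (n + 1)) with hα
  have hα1 (n : ℕ) : ‖α n‖ < 1 := hβ _ _
  refine ⟨α, hα1, fun k => 2 ^ (k + 1), fun i j hij =>
    Nat.pow_lt_pow_right one_lt_two (by omega), fun k => Nat.one_le_two_pow, fun u hu => ?_⟩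
  have hblock (k : ℕ) : schurIter α u 1 (2 ^ (k + 1) - 1) =
      schurIter (β k) u (schurIter α u 1 (2 ^ k - 1)) (2 ^ k) := by
    have hpos : 1 ≤ 2 ^ k := Nat.one_le_two_pow
    rw [show 2 ^ (k + 1) - 1 = (2 ^ k - 1) + 2 ^ k by rw [pow_succ]; omega, schurIter_add]
    refine schurIter_congr (fun i hi => ?_) _ _
    have hlog : Nat.log 2 (2 ^ k - 1 + i + 1) = k := by
      rw [Nat.log_eq_iff (Or.inr ⟨one_lt_two, by omega⟩), pow_succ]
      omega
    simp only [hα, hlog]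
    congr 1
    omega
  have hbound (k : ℕ) : ‖schurIter α u 1 (2 ^ (k + 1) - 1) - (r k : ℂ) * g u‖ ≤
      contractionFactor u ^ (2 ^ k) * 2 := by
    have hc := norm_schurIter_le hα1 hu (by simp : ‖(1 : ℂ)‖ ≤ 1) (2 ^ k - 1)
    rw [hblock]
    refine (happ k u _ hu hc).trans ?_
    refine mul_le_mul_of_nonneg_left ?_ (pow_nonneg (contractionFactor_nonneg u) _)
    refine (norm_sub_le _ _).trans ?_
    rw [norm_one, norm_mul, RCLike.norm_conj]
    have h1 := mul_le_one₀ ((hnorm k u hu).trans (hr1 k).le) (norm_nonneg _)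
      (norm_schurIter_le (hβ k) hu hc (2 ^ k))
    linarith
  have hq : Tendsto (fun k : ℕ => contractionFactor u ^ (2 ^ k) * 2) atTop (𝓝 0) := by
    simpa using ((tendsto_pow_atTop_nhds_zero_of_lt_one (contractionFactor_nonneg u)
      (contractionFactor_lt_one hu)).comp
        (tendsto_pow_atTop_atTop_of_one_lt (one_lt_two : 1 < 2))).mul_const (2 : ℝ)
  have h1 : Tendsto (fun k => (r k : ℂ) * g u) atTop (𝓝 (((1 : ℝ) : ℂ) * g u)) :=
    ((Complex.continuous_ofReal.tendsto _).comp (tendsto_natCast_div_add_atTop 1)).mul_const _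
  have h2 := (squeeze_zero_norm hbound hq).add h1
  simpa using h2

/-! ### The two directions of the theorem. -/

theorem conj_inv_conj_inv (u : ℂ) : (conj (conj u)⁻¹)⁻¹ = u := by
  rw [map_inv₀, Complex.conj_conj, inv_inv]

/-- The Cauchy transform outside the disc, in terms of the one inside the disc. -/
theorem integral_one_div_sub {ν : Measure ℂ} {z : ℂ} (hz : z ≠ 0) :
    ∫ w, 1 / (z - w) ∂ν = conj ((conj z)⁻¹ * discCauchy ν (conj z)⁻¹) := by
  rw [discCauchy, ← integral_const_mul, ← integral_conj]
  refine integral_congr_ae (Eventually.of_forall fun w => ?_)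
  have h : 1 - z⁻¹ * w = (z - w) / z := by field_simp
  simp only [map_mul, map_inv₀, Complex.conj_conj, map_div₀, map_one, map_sub, h]
  rw [one_div_div, inv_mul_eq_div, div_right_comm, div_self hz]

theorem one_add_mul_ne_zero {u h : ℂ} (hu : ‖u‖ < 1) (hh : ‖h‖ ≤ 1) : 1 + u * h ≠ 0 := by
  simpa using one_sub_mul_ne_zero (a := -u) (by simpa using hu) hh

theorem differentiableOn_schurIter {α : ℕ → ℂ} (hα : ∀ n, ‖α n‖ < 1) (n : ℕ) :
    DifferentiableOn ℂ (fun u => schurIter α u 1 n) (Metric.ball 0 1) := by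
  have h : DifferentiableOn ℂ
      (fun u => (szegoPoly α n).eval u / (szegoStar α n).eval u) (Metric.ball 0 1) :=
    (szegoPoly α n).differentiable.differentiableOn.div
      (szegoStar α n).differentiable.differentiableOn
      fun u hu => (szegoStar_bounds hα n (mem_ball_zero_iff.1 hu).le).1
  exact h.congr fun u hu => schurIter_one hα n (mem_ball_zero_iff.1 hu).le

/-- The approximants are Cauchy transforms of probability measures on the circle. -/
theorem exists_discCauchy_eq_schurIter {α : ℕ → ℂ} (hα : ∀ n, ‖α n‖ < 1) (n : ℕ) :
    ∃ ν, IsCircleProbability ν ∧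
      ∀ u, ‖u‖ < 1 → 1 / (1 + u * schurIter α u 1 n) = discCauchy ν u := by
  have hle (u : ℂ) (hu : ‖u‖ < 1) : ‖schurIter α u 1 n‖ ≤ 1 :=
    norm_schurIter_le hα hu (by simp) n
  refine exists_eq_discCauchy (F := fun u => 1 / (1 + u * schurIter α u 1 n)) ?_ (by simp)
    fun u hu => ?_
  · refine (differentiableOn_const 1).div ((differentiableOn_const 1).add
      (differentiableOn_id.mul (differentiableOn_schurIter hα n))) fun u hu => ?_
    have hu := mem_ball_zero_iff.1 hu
    exact one_add_mul_ne_zero hu (hle u hu)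
  · have h := half_le_re_one_div_one_sub (v := -(u * schurIter α u 1 n)) (by
      rw [norm_neg, norm_mul]
      exact (mul_le_of_le_one_right (norm_nonneg u) (hle u hu)).trans_lt hu)
    rwa [sub_neg_eq_add] at h

theorem isCauchyTransform_of_ratioTendsto {μ : Measure ℂ} (hμ : IsCircleProbability μ)
    (hinf : μ.support.Infinite) {N : ℕ → ℕ} (hN : ∀ k, 1 ≤ N k) {f : ℂ → ℂ}
    (hf : RatioTendsto μ N f) : ∃ ν, IsCircleProbability ν ∧ IsCauchyTransform ν f := by
  obtain ⟨α, hα, hΦ⟩ := exists_monicOP_eq_szegoPoly hμ hinf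
  choose ν hν hνF using fun k => exists_discCauchy_eq_schurIter hα (N k - 1)
  -- The point `u = 0` corresponds to `z = ∞`, where `f` says nothing; there every transform equals
  -- `1`.
  have hlim : ∀ u, ‖u‖ < 1 → Tendsto (fun k => discCauchy (ν k) u) atTop
      (𝓝 (if u = 0 then 1 else u⁻¹ * conj (f (conj u)⁻¹))) := by
    intro u hu
    split_ifs with h0
    · simp only [h0, discCauchy_zero (hν _)]
      exact tendsto_const_nhds
    · have hz : 1 < ‖(conj u)⁻¹‖ := by
        rw [norm_inv, RCLike.norm_conj]
        exact (one_lt_inv₀ (norm_pos_iff.2 h0)).2 hu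
      refine ((((Complex.continuous_conj.tendsto _).comp (hf _ hz)).const_mul u⁻¹)).congr
        fun k => ?_
      have h := monicOP_div_paraOP hα hΦ (N k - 1) hz
      rw [Nat.sub_add_cancel (hN k), conj_inv_conj_inv] at h
      rw [Function.comp_apply, h, Complex.conj_conj, ← hνF k u hu, ← mul_div_assoc,
        inv_mul_cancel₀ h0]
  obtain ⟨ρ, hρ, hρF⟩ := exists_eq_discCauchy_of_tendsto hν hlim
  refine ⟨ρ, hρ, fun z hz => ?_⟩
  have hz0 : z ≠ 0 := norm_pos_iff.1 (zero_lt_one.trans hz)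
  have hu0 : (conj z)⁻¹ ≠ 0 := inv_ne_zero ((_root_.map_ne_zero _).2 hz0)
  rw [integral_one_div_sub hz0, ← hρF _ (norm_conj_inv_lt_one hz), if_neg hu0,
    mul_inv_cancel_left₀ hu0, Complex.conj_conj, conj_inv_conj_inv]

/-- The half-plane `Re F ≥ 1/2` consists of the points at least as close to `1` as to `0`. -/
theorem norm_one_div_sub_one_le {F : ℂ} (hF : 1 / 2 ≤ F.re) : ‖1 / F - 1‖ ≤ 1 := by
  have h0 : F ≠ 0 := by rintro rfl; norm_num at hF
  have h1 : 1 / F - 1 = (1 - F) / F := by field_simp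
  rw [h1, norm_div]
  refine div_le_one_of_le₀ ?_ (norm_nonneg _)
  refine (sq_le_sq₀ (norm_nonneg _) (norm_nonneg _)).1 ?_
  simp only [← Complex.normSq_eq_norm_sq, Complex.normSq_apply, Complex.sub_re, Complex.sub_im,
    Complex.one_re, Complex.one_im]
  nlinarith

/-- The disc Cauchy transform of a probability measure comes from a Schur function. -/
theorem exists_schur_eq_discCauchy {ν : Measure ℂ} (hν : IsCircleProbability ν) :
    ∃ g : ℂ → ℂ, DifferentiableOn ℂ g (Metric.ball 0 1) ∧ (∀ u, ‖u‖ < 1 → ‖g u‖ ≤ 1) ∧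
      ∀ u, ‖u‖ < 1 → discCauchy ν u = 1 / (1 + u * g u) := by
  set G : ℂ → ℂ := fun u => 1 / discCauchy ν u - 1 with hG
  have hne (u : ℂ) (hu : ‖u‖ < 1) : discCauchy ν u ≠ 0 := by
    intro h
    have := half_le_re_discCauchy hν hu
    rw [h] at this
    norm_num at this
  have hd : DifferentiableOn ℂ G (Metric.ball 0 1) :=
    ((differentiableOn_const 1).div (differentiableOn_discCauchy hν)
      fun u hu => hne u (mem_ball_zero_iff.1 hu)).sub_const 1
  have hG0 : G 0 = 0 := by simp [hG, discCauchy_zero hν]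
  have hmaps : Set.MapsTo G (Metric.ball 0 1) (Metric.closedBall (G 0) 1) := by
    intro u hu
    rw [hG0, mem_closedBall_zero_iff]
    exact norm_one_div_sub_one_le (half_le_re_discCauchy hν (mem_ball_zero_iff.1 hu))
  -- Schwarz lemma: `G` vanishes at `0` and is bounded by `1`, hence so is `G u / u`.
  refine ⟨dslope G 0, (Complex.differentiableOn_dslope (Metric.ball_mem_nhds 0 one_pos)).2 hd,
    fun u hu => ?_, fun u hu => ?_⟩
  · simpa using Complex.norm_dslope_le_div_of_mapsTo_ball hd hmaps (mem_ball_zero_iff.2 hu)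
  · have h1 : u * dslope G 0 u = G u := by simpa [hG0] using sub_smul_dslope G 0 u
    rw [h1, hG]
    simp

theorem exists_ratioTendsto_of_isCauchyTransform {ν : Measure ℂ} (hν : IsCircleProbability ν)
    {f : ℂ → ℂ} (hf : IsCauchyTransform ν f) :
    ∃ μ, IsCircleProbability μ ∧ μ.support.Infinite ∧
      ∃ N : ℕ → ℕ, StrictMono N ∧ (∀ k, 1 ≤ N k) ∧ RatioTendsto μ N f := by
  obtain ⟨g, hgd, hg1, hgν⟩ := exists_schur_eq_discCauchy hν
  obtain ⟨α, hα, N, hNm, hN, hlim⟩ := exists_schurIter_tendsto hgd hg1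
  obtain ⟨μ, hμ, hinf, hΦ⟩ := exists_monicOP_eq_of_verblunsky hα
  refine ⟨μ, hμ, hinf, N, hNm, hN, fun z hz => ?_⟩
  have hu := norm_conj_inv_lt_one hz
  have hz0 : z ≠ 0 := norm_pos_iff.1 (zero_lt_one.trans hz)
  have h := (Complex.continuous_conj.tendsto _).comp (tendsto_const_nhds (x := (conj z)⁻¹) |>.div
    (((hlim _ hu).const_mul (conj z)⁻¹).const_add 1) (one_add_mul_ne_zero hu (hg1 _ hu)))
  rw [hf z hz, integral_one_div_sub hz0, hgν _ hu, mul_one_div]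
  refine h.congr fun k => ?_
  have h1 := monicOP_div_paraOP hα hΦ (N k - 1) hz
  rw [Nat.sub_add_cancel (hN k)] at h1
  exact h1.symm

end CirclePolynomials

end

theorem theorem3p3 :
    (∀ (μ : MeasureTheory.Measure ℂ), CirclePolynomials.IsCircleProbability μ →
      μ.support.Infinite →
      ∀ (N : ℕ → ℕ), StrictMono N → (∀ k, 1 ≤ N k) →
      ∀ (f : ℂ → ℂ), CirclePolynomials.RatioTendsto μ N f →
        ∃ ν : MeasureTheory.Measure ℂ, CirclePolynomials.IsCircleProbability ν ∧
          CirclePolynomials.IsCauchyTransform ν f) ∧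
    (∀ (ν : MeasureTheory.Measure ℂ), CirclePolynomials.IsCircleProbability ν →
      ∀ (f : ℂ → ℂ), CirclePolynomials.IsCauchyTransform ν f →
        ∃ μ : MeasureTheory.Measure ℂ, CirclePolynomials.IsCircleProbability μ ∧
          μ.support.Infinite ∧
          ∃ N : ℕ → ℕ, StrictMono N ∧ (∀ k, 1 ≤ N k) ∧
            CirclePolynomials.RatioTendsto μ N f) := by
  exact ⟨fun _ hμ hinf _ _ hN _ hf =>
      CirclePolynomials.isCauchyTransform_of_ratioTendsto hμ hinf hN hf,
    fun _ hν _ hf => CirclePolynomials.exists_ratioTendsto_of_isCauchyTransform hν hf⟩
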